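/- Let $k\ge 2$, $3\le r\le 2k$ and $n\ge 712k$ be integers. For a finite simple graph $G$, let $\lambda(G)$ denote the spectral radius of its adjacency matrix, i.e. the maximum modulus of its eigenvalues, and let $\chi(G)$ denote its chromatic number. Let $T_{m,2}$ be the complete bipartite graph on $m$ vertices with parts of sizes $\lfloor m/2\rfloor$ and $\lceil m/2\rceil$, and let $T_{n-r+1,2}\circ K_r$ be the $n$-vertex graph obtained by identifying a vertex of the complete graph $K_r$ with a vertex of the part of size $\lfloor (n-r+1)/2\rfloor$ of $T_{n-r+1,2}$. If $G$ is an $n$-vertex graph that contains no (not necessarily induced) subgraph isomorphic to the cycle $C_{2k+1}$ and satisfies $\chi(G)\ge r$, then $$\lambda(G)\le \lambda(T_{n-r+1,2}\circ K_r),$$ with equality if and only if $G$ is isomorphic to $T_{n-r+1,2}\circ K_r$. -/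

import Mathlib

open scoped ENNReal

/-- The spectral radius of a finite simple graph: the largest modulus of a (complex) eigenvalue of
its adjacency matrix. It is the supremum of the moduli over the finite spectrum, hence it is never
`⊤`. -/
noncomputable def SimpleGraph.adjSpectralRadius {V : Type*} [Fintype V] (G : SimpleGraph V) :
    ℝ≥0∞ := by
  classical
  exact spectralRadius ℂ (G.adjMatrix ℂ)

/-- The graph obtained from the disjoint union of `G` and `H` by identifying the vertex `a` of `G`
with the vertex `b` of `H`. The identified vertex is represented by `a`. -/
def SimpleGraph.identifyVertex {V W : Type*} (G : SimpleGraph V) (a : V)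
    (H : SimpleGraph W) (b : W) : SimpleGraph (V ⊕ {w : W // w ≠ b}) where
  Adj
    | .inl x, .inl y => G.Adj x y
    | .inl x, .inr w => x = a ∧ H.Adj b w
    | .inr w, .inl x => x = a ∧ H.Adj b w
    | .inr w, .inr z => H.Adj w z
  symm := by
    constructor
    rintro (x | w) (y | z) h
    · exact SimpleGraph.Adj.symm (G := G) h
    · exact h
    · exact h
    · exact SimpleGraph.Adj.symm (G := H) h
  loopless := by
    constructor
    rintro (x | w) h
    · exact G.irrefl h
    · exact H.irrefl h

/-- The bipartite Turán graph on `m` vertices: the complete bipartite graph whose left part has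
`⌊m / 2⌋` vertices and whose right part has `⌈m / 2⌉` vertices. -/
abbrev bipartiteTuranGraph (m : ℕ) : SimpleGraph (Fin (m / 2) ⊕ Fin ((m + 1) / 2)) :=
  completeBipartiteGraph (Fin (m / 2)) (Fin ((m + 1) / 2))

/-- The graph on `n` vertices obtained by identifying a vertex of the complete graph on `r`
vertices with a vertex of the smaller (left) part of the bipartite Turán graph on `n - r + 1`
vertices. -/
def turanIdentifyClique (n r : ℕ) (hr : 1 ≤ r) (hn : r < n) :
    SimpleGraph ((Fin ((n - r + 1) / 2) ⊕ Fin ((n - r + 1 + 1) / 2)) ⊕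
      {w : Fin r // w ≠ ⟨0, hr⟩}) :=
  (bipartiteTuranGraph (n - r + 1)).identifyVertex (.inl ⟨0, by omega⟩)
    (SimpleGraph.completeGraph (Fin r)) ⟨0, hr⟩

/-!
The moduli of an eigenvector form a vector `x ≥ 0` with `λ x ≤ A x`, where `λ = λ(G)` may be assumed
to be at least `λ(T_{n-r+1,2} ∘ K_r)`, hence at least `0.4985 n`. The neighbourhood of a vertex of a
`C_{2k+1}`-free graph induces no path of length `2k - 1`, so it spans few edges. Counting walks of
length two from a maximal entry of `x` therefore shows that this neighbourhood and its complement
are nearly balanced and almost completely joined. Two vertices of high degree into these classes are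
joined by paths of every moderate length of the right parity, so that an edge within a class would
close a `C_{2k+1}`. This produces disjoint independent sets `A` and `B` outside of which few
vertices remain. The bound on `λ` leaves so few of them that `χ(G) ≥ r` forces their number to be
`c = r - 1`: they form a clique, completely joined to a single vertex of, say, `A`, and have no
other neighbours.

For such graphs, summing the eigenvector inequalities gives `λ² ≤ |B| (|A| + κ(λ))`, where
`κ(λ) = c / ((λ + 1)(λ - c))`, with equality only if all edges between `A` and `B` are present.
Since `κ` is decreasing and `0 < κ < 1`, the best split of `|A| + |B| = n - c` is
`|A| = ⌊(n - c) / 2⌋`.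
-/

namespace OddCycleSpectral

open SimpleGraph Finset

section NeighborsIn

variable {V : Type*} {G : SimpleGraph V} {S T : Finset V} {u v w : V}

open Classical in
/-- The neighbours of `v` in the finset `S`. Its cardinality is the degree of `v` into `S`, and
summing a vector over it gives the part of the adjacency matrix action coming from `S`. -/
noncomputable def neighborsIn (G : SimpleGraph V) (v : V) (S : Finset V) : Finset V :=
  {w ∈ S | G.Adj v w}

@[simp]
theorem mem_neighborsIn : w ∈ neighborsIn G v S ↔ w ∈ S ∧ G.Adj v w := by simp [neighborsIn]

theorem neighborsIn_subset : neighborsIn G v S ⊆ S := by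
  classical exact filter_subset _ _

theorem neighborsIn_mono (h : S ⊆ T) : neighborsIn G v S ⊆ neighborsIn G v T := by
  classical exact filter_subset_filter _ h

theorem card_neighborsIn_le : #(neighborsIn G v S) ≤ #S :=
  card_le_card neighborsIn_subset

theorem card_neighborsIn_lt (hw : w ∈ S) (hvw : ¬ G.Adj v w) : #(neighborsIn G v S) < #S := by
  classical exact card_lt_card (filter_ssubset.mpr ⟨w, hw, hvw⟩)

theorem card_neighborsIn_pos : 0 < #(neighborsIn G v S) ↔ ∃ w ∈ S, G.Adj v w := by
  simp [card_pos, Finset.Nonempty]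

theorem neighborsIn_eq_empty (h : ∀ w ∈ S, ¬ G.Adj v w) : neighborsIn G v S = ∅ := by
  classical exact filter_false_of_mem h

theorem neighborsIn_union [DecidableEq V] :
    neighborsIn G v (S ∪ T) = neighborsIn G v S ∪ neighborsIn G v T := by
  classical exact filter_union _ _ _

theorem disjoint_neighborsIn (h : Disjoint S T) :
    Disjoint (neighborsIn G v S) (neighborsIn G v T) := by
  classical exact disjoint_filter_filter h

theorem card_neighborsIn_union [DecidableEq V] (h : Disjoint S T) :
    #(neighborsIn G v (S ∪ T)) = #(neighborsIn G v S) + #(neighborsIn G v T) := by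
  rw [neighborsIn_union, card_union_of_disjoint (disjoint_neighborsIn h)]

theorem sum_neighborsIn_union [DecidableEq V] {M : Type*} [AddCommMonoid M] (x : V → M)
    (h : Disjoint S T) :
    ∑ w ∈ neighborsIn G v (S ∪ T), x w =
      ∑ w ∈ neighborsIn G v S, x w + ∑ w ∈ neighborsIn G v T, x w := by
  rw [neighborsIn_union, sum_union (disjoint_neighborsIn h)]

theorem card_sub_card_neighborsIn_mono (h : S ⊆ T) :
    (#S - #(neighborsIn G v S) : ℝ) ≤ #T - #(neighborsIn G v T) := by
  classical
  have hunion := card_neighborsIn_union (G := G) (v := v) (disjoint_sdiff : Disjoint S (T \ S))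
  rw [union_sdiff_of_subset h] at hunion
  have hle : #S + #(neighborsIn G v T) ≤ #T + #(neighborsIn G v S) := by
    have := card_sdiff_add_card_eq_card h
    have := card_neighborsIn_le (G := G) (v := v) (S := T \ S)
    omega
  have : (#S + #(neighborsIn G v T) : ℝ) ≤ #T + #(neighborsIn G v S) := by exact_mod_cast hle
  linarith

theorem sum_sum_neighborsIn {M : Type*} [AddCommMonoid M] (x : V → M) (S T : Finset V) :
    ∑ v ∈ S, ∑ w ∈ neighborsIn G v T, x w = ∑ w ∈ T, #(neighborsIn G w S) • x w := by
  rw [sum_comm' (t' := T) (s' := fun w => neighborsIn G w S)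
    (by simp only [mem_neighborsIn, G.adj_comm]; tauto)]
  exact sum_congr rfl fun w _ => sum_const _

theorem sum_card_neighborsIn_comm (S T : Finset V) :
    ∑ v ∈ S, #(neighborsIn G v T) = ∑ w ∈ T, #(neighborsIn G w S) := by
  simpa only [← card_eq_sum_ones, smul_eq_mul, mul_one] using
    sum_sum_neighborsIn (G := G) (fun _ => (1 : ℕ)) S T

theorem sum_neighborsIn_le {x : V → ℝ} {M : ℝ} (hM : ∀ v, x v ≤ M) :
    ∑ w ∈ neighborsIn G v S, x w ≤ #(neighborsIn G v S) * M := by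
  rw [← nsmul_eq_mul]
  exact sum_le_card_nsmul _ _ _ fun w _ => hM w

theorem sum_neighborsIn_le_sum {x : V → ℝ} (hx : ∀ v, 0 ≤ x v) :
    ∑ w ∈ neighborsIn G v S, x w ≤ ∑ w ∈ S, x w :=
  sum_le_sum_of_subset_of_nonneg neighborsIn_subset fun w _ _ => hx w

end NeighborsIn

section Paths

variable {V : Type*} {G : SimpleGraph V} {P Q S : Finset V} {d k : ℕ}

theorem sum_card_neighborsIn_insert [DecidableEq V] {v : V} (hv : v ∉ S) :
    ∑ w ∈ insert v S, #(neighborsIn G w (insert v S)) =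
      ∑ w ∈ S, #(neighborsIn G w S) + 2 * #(neighborsIn G v S) := by
  have hself : neighborsIn G v {v} = ∅ := neighborsIn_eq_empty (by simp)
  have hstar := sum_card_neighborsIn_comm (G := G) S {v}
  have hsplit (w : V) :
      #(neighborsIn G w (insert v S)) = #(neighborsIn G w {v}) + #(neighborsIn G w S) := by
    rw [insert_eq, card_neighborsIn_union (disjoint_singleton_left.mpr hv)]
  simp only [sum_singleton] at hstar
  simp only [hsplit, sum_insert hv, sum_add_distrib, hself, card_empty, hstar]
  ring

-- Successively delete vertices of degree at most `d`; each deletion costs at most `2 * d`.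
theorem exists_subset_forall_lt_card_neighborsIn
    (h : 2 * d * #S < ∑ v ∈ S, #(neighborsIn G v S)) :
    ∃ T ⊆ S, T.Nonempty ∧ ∀ v ∈ T, d < #(neighborsIn G v T) := by
  classical
  induction S using Finset.strongInduction with
  | H S ih =>
    by_cases hS : ∀ v ∈ S, d < #(neighborsIn G v S)
    · exact ⟨S, subset_rfl, nonempty_iff_ne_empty.mpr (by rintro rfl; simp at h), hS⟩
    push Not at hS
    obtain ⟨v, hv, hvd⟩ := hS
    have hvd' : #(neighborsIn G v (S.erase v)) ≤ d :=
      (card_le_card (neighborsIn_mono (erase_subset v S))).trans hvd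
    have hsum := sum_card_neighborsIn_insert (G := G) (notMem_erase v S)
    rw [insert_erase hv] at hsum
    have hcard := card_erase_add_one hv
    obtain ⟨T, hT, hTd⟩ := ih (S.erase v) (erase_ssubset hv) (by nlinarith)
    exact ⟨T, hT.trans (erase_subset v S), hTd⟩

theorem exists_isPath_of_forall_lt_card_neighborsIn (h : ∀ v ∈ S, d < #(neighborsIn G v S))
    {v : V} (hv : v ∈ S) {m : ℕ} (hm : m ≤ d + 1) :
    ∃ u ∈ S, ∃ p : G.Walk u v, p.IsPath ∧ p.length = m ∧ ∀ w ∈ p.support, w ∈ S := by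
  classical
  induction m with
  | zero => exact ⟨v, hv, .nil, by simp, by simp, by simpa using hv⟩
  | succ m ih =>
    obtain ⟨u, hu, p, hp, hpl, hpS⟩ := ih (by omega)
    obtain ⟨w, hw, hwp⟩ : ∃ w ∈ neighborsIn G u S, w ∉ p.support.toFinset.erase u := by
      refine exists_mem_notMem_of_card_lt_card (lt_of_le_of_lt ?_ (h u hu))
      have := p.support.toFinset_card_le
      rw [card_erase_of_mem (by simp)]
      rw [Walk.length_support] at this
      omega
    rw [mem_neighborsIn] at hw
    have hwu : w ∉ p.support := fun hc => hwp (by simp [hc, hw.2.ne'])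
    refine ⟨w, hw.1, .cons hw.2.symm p, hp.cons hwu, by simp [hpl], fun z hz => ?_⟩
    rcases List.mem_cons.mp hz with rfl | hz
    · exact hw.1
    · exact hpS z hz

theorem not_adj_of_isPath_of_free (hk : 1 ≤ k) (hfree : (cycleGraph (2 * k + 1)).Free G) {a b : V}
    {p : G.Walk a b} (hp : p.IsPath) (hl : p.length = 2 * k) : ¬ G.Adj b a := by
  refine fun hba => hfree ((cycleGraph_isContained_iff (by omega)).mpr ⟨b, .cons hba p, ?_, ?_⟩)
  · refine Walk.cons_isCycle_iff _ _ |>.mpr ⟨hp, fun he => ?_⟩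
    have := hp.length_eq_one_of_mem_edges (by rwa [Sym2.eq_swap] at he)
    omega
  · simp [hl]

theorem sum_card_neighborsIn_le_of_forall_adj (hk : 1 ≤ k)
    (hfree : (cycleGraph (2 * k + 1)).Free G) {u : V} (hS : ∀ v ∈ S, G.Adj u v) :
    ∑ v ∈ S, #(neighborsIn G v S) ≤ 2 * (2 * k - 2) * #S := by
  by_contra! hdense
  obtain ⟨T, hTS, ⟨v, hv⟩, hT⟩ := exists_subset_forall_lt_card_neighborsIn hdense
  obtain ⟨w, hw, p, hp, hpl, hpT⟩ :=
    exists_isPath_of_forall_lt_card_neighborsIn hT hv (m := 2 * k - 1) (by omega)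
  have hu : u ∉ p.support := fun hc => G.irrefl (hS u (hTS (hpT u hc)))
  exact not_adj_of_isPath_of_free hk hfree (p := .cons (hS w (hTS hw)) p) (hp.cons hu)
    (by simp only [Walk.length_cons]; omega) (hS v (hTS hv)).symm

theorem neighborsIn_between_union [DecidableEq V] (hPQ : Disjoint P Q) {v : V} (hv : v ∈ P) :
    neighborsIn (G.between P Q) v (P ∪ Q) = neighborsIn G v Q := by
  ext w
  have := Finset.disjoint_left.mp hPQ hv
  simp only [mem_neighborsIn, mem_union, between_adj, mem_coe]
  tauto

theorem mem_left_of_odd_length_of_between (hPQ : Disjoint P Q) {y z : V}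
    (p : (G.between P Q).Walk y z) (hp : Odd p.length) (hz : z ∈ Q) : y ∈ P := by
  classical
  let side : (G.between P Q).Coloring Bool := Coloring.mk (fun v => decide (v ∈ P)) (by
    intro a b hab
    have hleft {v : V} (hv : v ∈ P) : v ∉ Q := Finset.disjoint_left.mp hPQ hv
    simp only [between_adj, mem_coe] at hab
    grind)
  have hz' : z ∉ P := fun hc => Finset.disjoint_left.mp hPQ hc hz
  have hne : ¬ side y = true ↔ side z = true := (side.odd_length_iff_not_congr p).mp hp
  have hside (v : V) : side v = decide (v ∈ P) := rfl
  simpa [hside, hz'] using hne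

theorem exists_isPath_between (hPQ : Disjoint P Q)
    (h : 2 * k * (#P + #Q) < ∑ v ∈ P, #(neighborsIn G v Q)) {j : ℕ} (hj : 1 ≤ j) (hjk : j ≤ k) :
    ∃ y ∈ P, ∃ z ∈ Q, ∃ p : G.Walk y z, p.IsPath ∧ p.length + 1 = 2 * j ∧
      ∀ w ∈ p.support, w ∈ P ∨ w ∈ Q := by
  classical
  have hP {v : V} (hv : v ∈ P) := neighborsIn_between_union (G := G) hPQ hv
  have hQ {v : V} (hv : v ∈ Q) : neighborsIn (G.between P Q) v (P ∪ Q) = neighborsIn G v P := by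
    rw [between_comm, union_comm, neighborsIn_between_union hPQ.symm hv]
  obtain ⟨T, hTS, ⟨v, hvT⟩, hT⟩ :=
      exists_subset_forall_lt_card_neighborsIn (G := G.between P Q) (d := 2 * k) (S := P ∪ Q) (by
    rw [sum_union hPQ, sum_congr rfl (fun v hv => congrArg card (hP hv)),
      sum_congr rfl (fun v hv => congrArg card (hQ hv)), ← sum_card_neighborsIn_comm P Q,
      card_union_of_disjoint hPQ]
    linarith)
  obtain ⟨z, hzT, hzQ⟩ : ∃ z ∈ T, z ∈ Q := by
    rcases mem_union.mp (hTS hvT) with hv | hv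
    · obtain ⟨w, hw⟩ := card_pos.mp ((Nat.zero_le _).trans_lt (hT v hvT))
      have hwQ := neighborsIn_mono hTS hw
      rw [hP hv, mem_neighborsIn] at hwQ
      exact ⟨w, neighborsIn_subset hw, hwQ.1⟩
    · exact ⟨v, hvT, hv⟩
  obtain ⟨y, -, p, hp, hpl, hpT⟩ :=
    exists_isPath_of_forall_lt_card_neighborsIn hT hzT (m := 2 * j - 1) (by omega)
  have hyP : y ∈ P :=
    mem_left_of_odd_length_of_between hPQ p (by rw [hpl]; exact ⟨j - 1, by omega⟩) hzQ
  refine ⟨y, hyP, z, hzQ, p.mapLe between_le, (Walk.isPath_mapLe _).mpr hp, ?_, fun w hw => ?_⟩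
  · simp only [Walk.length_map]
    omega
  · rw [Walk.support_mapLe_eq_support] at hw
    exact mem_union.mp (hTS (hpT w hw))

theorem not_adj_of_ear_of_free_cycleGraph_five {a a' b w w' : V}
    (hfree : (cycleGraph 5).Free G) (hne : a ≠ a')
    (hwa'_ne : w ≠ a') (hw'a_ne : w' ≠ a) (hbw : b ≠ w) (hbw' : b ≠ w')
    (hww' : G.Adj w w') (hwa : G.Adj w a) (hwa' : G.Adj w' a') (hba : G.Adj b a) :
    ¬ G.Adj b a' := by
  intro hba'
  refine not_adj_of_isPath_of_free (k := 2) (by omega) hfree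
    (p := .cons hba (.cons hwa.symm (.cons hww' (.cons hwa' .nil)))) ?_ rfl hba'.symm
  simp only [Walk.cons_isPath_iff, Walk.support_cons, List.mem_cons, not_or, Walk.support_nil,
    Walk.IsPath.nil, List.not_mem_nil, not_false_eq_true, and_true, true_and]
  exact ⟨⟨⟨hwa'.ne, hww'.ne, hwa'_ne⟩, hwa.ne', hw'a_ne.symm, hne⟩, hba.ne, hbw, hbw', hba'.ne⟩

end Paths

section IndepPair

variable {V : Type*} {G : SimpleGraph V} {A B : Finset V}

/-- Two disjoint independent sets of vertices. -/
structure IsIndepPair (G : SimpleGraph V) (A B : Finset V) : Prop where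
  disjoint : Disjoint A B
  not_adj_left : ∀ u ∈ A, ∀ v ∈ A, ¬ G.Adj u v
  not_adj_right : ∀ u ∈ B, ∀ v ∈ B, ¬ G.Adj u v

theorem IsIndepPair.symm (h : IsIndepPair G A B) : IsIndepPair G B A :=
  ⟨h.disjoint.symm, h.not_adj_right, h.not_adj_left⟩

end IndepPair

section DensePair

variable {V : Type*} [Fintype V] {G : SimpleGraph V} {k : ℕ} {X Y P Q S F : Finset V}
  {a a' b w w' : V}

/-- A partition of the `n` vertices into two classes of roughly equal size that are joined by all
but `0.0048 * n ^ 2` of the possible edges. -/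
structure IsDensePair (G : SimpleGraph V) (X Y : Finset V) : Prop where
  disjoint : Disjoint X Y
  mem_or_mem : ∀ v, v ∈ X ∨ v ∈ Y
  card_left_le : (#X : ℝ) ≤ 0.585 * Fintype.card V
  card_right_le : (#Y : ℝ) ≤ 0.585 * Fintype.card V
  card_mul_card_le : (#X * #Y : ℝ) ≤
    ∑ v ∈ X, (#(neighborsIn G v Y) : ℝ) + 0.0048 * (Fintype.card V : ℝ) ^ 2

open Classical in
/-- The vertices with at least `0.08 * n` neighbours in `S`. For a dense pair `X`, `Y` the sets
`heavy G Y` and `heavy G X` are the cleaned-up versions of `X` and `Y`. -/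
noncomputable def heavy (G : SimpleGraph V) (S : Finset V) : Finset V :=
  {v | 0.08 * (Fintype.card V : ℝ) ≤ #(neighborsIn G v S)}

theorem mem_heavy : w ∈ heavy G S ↔ 0.08 * (Fintype.card V : ℝ) ≤ #(neighborsIn G w S) := by
  simp [heavy]

theorem le_card_sdiff_of_mem_heavy [DecidableEq V] (ha : a ∈ heavy G S) {m : ℕ} (hF : #F ≤ m) :
    0.08 * (Fintype.card V : ℝ) - m ≤ #(neighborsIn G a S \ F) := by
  have hcard : #(neighborsIn G a S) ≤ #(neighborsIn G a S \ F) + m := by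
    have := le_card_sdiff F (neighborsIn G a S)
    omega
  have : (#(neighborsIn G a S) : ℝ) ≤ #(neighborsIn G a S \ F) + m := by exact_mod_cast hcard
  linarith [mem_heavy.mp ha]

theorem le_cast_card (hk : 2 ≤ k) (hn : 712 * k ≤ Fintype.card V) :
    (1424 : ℝ) ≤ Fintype.card V := by
  exact_mod_cast (by omega : 1424 ≤ Fintype.card V)

namespace IsDensePair

theorem symm (h : IsDensePair G X Y) : IsDensePair G Y X where
  disjoint := h.disjoint.symm
  mem_or_mem v := (h.mem_or_mem v).symm
  card_left_le := h.card_right_le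
  card_right_le := h.card_left_le
  card_mul_card_le := by
    have hcomm : ∑ v ∈ X, (#(neighborsIn G v Y) : ℝ) = ∑ v ∈ Y, (#(neighborsIn G v X) : ℝ) := by
      exact_mod_cast sum_card_neighborsIn_comm X Y
    rw [mul_comm, ← hcomm]
    exact h.card_mul_card_le

theorem card_add_card (h : IsDensePair G X Y) : (#X + #Y : ℝ) = Fintype.card V := by
  classical
  have huniv : X ∪ Y = univ := by
    ext v
    simpa using h.mem_or_mem v
  exact_mod_cast (card_union_of_disjoint h.disjoint).symm.trans (congrArg card huniv)

theorem le_card_right (h : IsDensePair G X Y) : 0.415 * (Fintype.card V : ℝ) ≤ #Y := by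
  linarith [h.card_add_card, h.card_left_le]

theorem card_mul_card_le_of_subset (h : IsDensePair G X Y) (hP : P ⊆ X) (hQ : Q ⊆ Y) :
    (#P * #Q : ℝ) ≤ ∑ v ∈ P, (#(neighborsIn G v Q) : ℝ) + 0.0048 * (Fintype.card V : ℝ) ^ 2 := by
  have hmissing : ∑ v ∈ P, (#Q - #(neighborsIn G v Q) : ℝ) ≤
      ∑ v ∈ X, (#Y - #(neighborsIn G v Y) : ℝ) :=
    (sum_le_sum fun v _ => card_sub_card_neighborsIn_mono hQ).trans <|
      sum_le_sum_of_subset_of_nonneg hP fun v _ _ =>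
        sub_nonneg.mpr (by exact_mod_cast card_neighborsIn_le)
  simp only [sum_sub_distrib, sum_const, nsmul_eq_mul] at hmissing
  linarith [h.card_mul_card_le]

theorem card_le_of_forall_notMem_heavy (h : IsDensePair G X Y) [Nonempty V] (hS : S ⊆ X)
    (hlight : ∀ v ∈ S, v ∉ heavy G Y) : (#S : ℝ) ≤ 0.0145 * Fintype.card V := by
  have hN : (0 : ℝ) < Fintype.card V := by exact_mod_cast Fintype.card_pos
  have hmul := h.card_mul_card_le_of_subset hS subset_rfl
  have hsum : ∑ v ∈ S, (#(neighborsIn G v Y) : ℝ) ≤ #S * (0.08 * Fintype.card V) := by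
    rw [← nsmul_eq_mul]
    exact sum_le_card_nsmul _ _ _ fun v hv => (not_le.mp (mem_heavy.not.mp (hlight v hv))).le
  have := h.le_card_right
  by_contra! hc
  nlinarith

theorem exists_isPath_of_mem_heavy (h : IsDensePair G X Y) (hk : 2 ≤ k)
    (hn : 712 * k ≤ Fintype.card V) (ha : a ∈ heavy G Y) (hb : b ∈ heavy G X) (hF : #F ≤ 5)
    {j : ℕ} (hj : 1 ≤ j) (hjk : j ≤ k) :
    ∃ y x, ∃ p : G.Walk y x, p.IsPath ∧ p.length + 1 = 2 * j ∧ G.Adj a y ∧ G.Adj b x ∧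
      ∀ w ∈ p.support, w ∉ F := by
  classical
  have hP := le_card_sdiff_of_mem_heavy ha hF
  have hQ := le_card_sdiff_of_mem_heavy hb hF
  have hPY : neighborsIn G a Y \ F ⊆ Y := sdiff_subset.trans neighborsIn_subset
  have hQX : neighborsIn G b X \ F ⊆ X := sdiff_subset.trans neighborsIn_subset
  set P := neighborsIn G a Y \ F with hP_def
  set Q := neighborsIn G b X \ F with hQ_def
  have hdense : (2 * k * (#P + #Q) : ℝ) < ∑ v ∈ P, (#(neighborsIn G v Q) : ℝ) := by
    have hmul := h.symm.card_mul_card_le_of_subset hPY hQX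
    have hN := le_cast_card hk hn
    have hkN : (712 * k : ℝ) ≤ Fintype.card V := by exact_mod_cast hn
    have hprod : (0.0735 * Fintype.card V) * (0.0735 * Fintype.card V) ≤
        (#P - 2 * k) * (#Q - 2 * k : ℝ) := by
      push_cast at hP hQ
      apply mul_le_mul <;> linarith
    nlinarith [k.cast_nonneg (α := ℝ)]
  obtain ⟨y, hy, x, hx, p, hp, hpl, hpPQ⟩ :=
    exists_isPath_between (h.symm.disjoint.mono hPY hQX) (by exact_mod_cast hdense) hj hjk
  simp only [hP_def, hQ_def, mem_sdiff, mem_neighborsIn] at hy hx hpPQ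
  exact ⟨y, x, p, hp, hpl, hy.1.2, hx.1.2, fun w hw => (hpPQ w hw).elim (·.2) (·.2)⟩

theorem exists_isPath_of_mem_heavy_of_mem_heavy (h : IsDensePair G X Y) (hk : 2 ≤ k)
    (hn : 712 * k ≤ Fintype.card V) (ha : a ∈ heavy G Y) (ha' : a' ∈ heavy G Y) (hF : #F ≤ 4)
    {j : ℕ} (hj : 1 ≤ j) (hjk : j ≤ k) :
    ∃ y z, ∃ p : G.Walk y z, p.IsPath ∧ p.length = 2 * j ∧ G.Adj a y ∧ G.Adj a' z ∧
      ∀ w ∈ p.support, w ∉ F := by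
  classical
  have hN := le_cast_card hk hn
  have : Nonempty V := ⟨a⟩
  obtain ⟨z, hz, hzX⟩ : ∃ z ∈ neighborsIn G a' Y \ F, z ∈ heavy G X := by
    by_contra! hlight
    have hsmall := h.symm.card_le_of_forall_notMem_heavy
      (sdiff_subset.trans neighborsIn_subset) hlight
    have := le_card_sdiff_of_mem_heavy ha' hF
    push_cast at this
    linarith
  rw [mem_sdiff, mem_neighborsIn] at hz
  obtain ⟨y, x, p, hp, hpl, hy, hx, hpF⟩ := h.exists_isPath_of_mem_heavy hk hn ha hzX
    ((card_insert_le z F).trans (by omega)) hj hjk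
  simp only [mem_insert, not_or] at hpF
  refine ⟨y, z, p.concat hx.symm, (Walk.concat_isPath_iff _).mpr ⟨hp, fun hc => (hpF z hc).1 rfl⟩,
    (Walk.length_concat _ _).trans hpl, hy, hz.1.2, fun w hw => ?_⟩
  rw [Walk.support_concat, List.mem_append, List.mem_singleton] at hw
  rcases hw with hw | rfl
  · exact (hpF w hw).2
  · exact hz.2

theorem disjoint_heavy (h : IsDensePair G X Y) (hk : 2 ≤ k) (hn : 712 * k ≤ Fintype.card V)
    (hfree : (cycleGraph (2 * k + 1)).Free G) : Disjoint (heavy G Y) (heavy G X) := by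
  rw [Finset.disjoint_left]
  intro v hvY hvX
  obtain ⟨y, x, p, hp, hpl, hy, hx, hpv⟩ := h.exists_isPath_of_mem_heavy hk hn hvY hvX
    (F := {v}) (by simp) (by omega : 1 ≤ k) le_rfl
  exact not_adj_of_isPath_of_free (by omega) hfree (p := .cons hy p)
    (hp.cons fun hc => hpv v hc (mem_singleton_self v)) (by simpa using hpl) hx.symm

theorem not_adj_of_mem_heavy (h : IsDensePair G X Y) (hk : 2 ≤ k)
    (hn : 712 * k ≤ Fintype.card V) (hfree : (cycleGraph (2 * k + 1)).Free G)
    (ha : a ∈ heavy G Y) (ha' : a' ∈ heavy G Y) : ¬ G.Adj a a' := by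
  classical
  intro hadj
  obtain ⟨y, x, p, hp, hpl, hy, hx, hpF⟩ :=
    h.exists_isPath_of_mem_heavy_of_mem_heavy hk hn ha ha' (F := {a, a'})
      (card_le_two.trans (by omega)) (by omega : 1 ≤ k - 1) (by omega)
  simp only [mem_insert, mem_singleton, not_or] at hpF
  refine not_adj_of_isPath_of_free (by omega) hfree (p := .cons hadj.symm (.cons hy p)) ?_
    (by simp only [Walk.length_cons]; omega) hx.symm
  simp only [Walk.cons_isPath_iff, Walk.support_cons, List.mem_cons, not_or]
  exact ⟨⟨hp, fun hc => (hpF a hc).1 rfl⟩, hadj.ne', fun hc => (hpF a' hc).2 rfl⟩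

theorem not_adj_of_adj_of_mem_heavy (h : IsDensePair G X Y) (hk : 2 ≤ k)
    (hn : 712 * k ≤ Fintype.card V) (hfree : (cycleGraph (2 * k + 1)).Free G)
    (ha : a ∈ heavy G Y) (hb : b ∈ heavy G X) (hwa : G.Adj w a) : ¬ G.Adj w b := by
  classical
  intro hwb
  have hab : a ≠ b := disjoint_iff_ne.mp (h.disjoint_heavy hk hn hfree) a ha b hb
  obtain ⟨y, x, p, hp, hpl, hy, hx, hpF⟩ := h.exists_isPath_of_mem_heavy hk hn ha hb
    (F := {w, a, b}) (card_le_three.trans (by omega)) (by omega : 1 ≤ k - 1) (by omega)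
  simp only [mem_insert, mem_singleton, not_or] at hpF
  refine not_adj_of_isPath_of_free (by omega) hfree
    (p := .cons hwb.symm (.cons hwa (.cons hy p))) ?_
    (by simp only [Walk.length_cons]; omega) hx.symm
  simp only [Walk.cons_isPath_iff, Walk.support_cons, List.mem_cons, not_or]
  exact ⟨⟨⟨hp, fun hc => (hpF a hc).2.1 rfl⟩, hwa.ne, fun hc => (hpF w hc).1 rfl⟩,
    hwb.ne', hab.symm, fun hc => (hpF b hc).2.2 rfl⟩

theorem eq_two_of_ear (h : IsDensePair G X Y) (hk : 2 ≤ k) (hn : 712 * k ≤ Fintype.card V)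
    (hfree : (cycleGraph (2 * k + 1)).Free G) (ha : a ∈ heavy G Y) (ha' : a' ∈ heavy G Y)
    (hne : a ≠ a') (hw : w ∉ heavy G Y) (hw' : w' ∉ heavy G Y)
    (hww' : G.Adj w w') (hwa : G.Adj w a) (hwa' : G.Adj w' a') : k = 2 := by
  classical
  by_contra hk2
  obtain ⟨y, x, p, hp, hpl, hy, hx, hpF⟩ :=
    h.exists_isPath_of_mem_heavy_of_mem_heavy hk hn ha ha' (F := {w, w', a, a'})
      card_le_four (by omega : 1 ≤ k - 2) (by omega)
  simp only [mem_insert, mem_singleton, not_or] at hpF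
  refine not_adj_of_isPath_of_free (by omega) hfree
    (p := .cons hwa'.symm (.cons hww'.symm (.cons hwa (.cons hy p)))) ?_
    (by simp only [Walk.length_cons]; omega) hx.symm
  simp only [Walk.cons_isPath_iff, Walk.support_cons, List.mem_cons, not_or]
  exact ⟨⟨⟨⟨hp, fun hc => (hpF a hc).2.2.1 rfl⟩, hwa.ne, fun hc => (hpF w hc).1 rfl⟩,
    hww'.ne', ne_of_mem_of_not_mem ha hw' |>.symm, fun hc => (hpF w' hc).2.1 rfl⟩, hwa'.ne',
    ne_of_mem_of_not_mem ha' hw, hne.symm, fun hc => (hpF a' hc).2.2.2 rfl⟩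

end IsDensePair

end DensePair

section Core

variable {V : Type*} [Fintype V] {G : SimpleGraph V} {k : ℕ} {A B X Y S : Finset V} {v w : V}

open Classical in
/-- The vertices that lie in neither `A` nor `B`. -/
noncomputable def outside (A B : Finset V) : Finset V := (A ∪ B)ᶜ

@[simp]
theorem mem_outside : w ∈ outside A B ↔ w ∉ A ∧ w ∉ B := by simp [outside]

theorem outside_comm (A B : Finset V) : outside A B = outside B A := by
  simp [outside, union_comm]

theorem card_add_card_add_card_outside (h : Disjoint A B) :
    #A + #B + #(outside A B) = Fintype.card V := by
  classical
  rw [outside, ← card_union_of_disjoint h]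
  convert card_add_card_compl (A ∪ B)

theorem sum_neighborsIn_univ {M : Type*} [AddCommMonoid M] (h : Disjoint A B) (x : V → M) :
    ∑ w ∈ neighborsIn G v univ, x w = ∑ w ∈ neighborsIn G v A, x w +
      ∑ w ∈ neighborsIn G v B, x w + ∑ w ∈ neighborsIn G v (outside A B), x w := by
  classical
  have huniv : univ = A ∪ B ∪ outside A B := by
    ext w
    simp only [mem_univ, mem_union, mem_outside]
    tauto
  have hdisj : Disjoint (A ∪ B) (outside A B) := by
    rw [Finset.disjoint_left]
    intro w hw hw'
    rw [mem_outside] at hw'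
    simp only [mem_union] at hw
    tauto
  rw [huniv, sum_neighborsIn_union x hdisj, sum_neighborsIn_union x h]

/-- An almost spanning pair of independent sets `A`, `B` such that every other vertex has few
neighbours in `A ∪ B`, all of them on one side, and an edge outside `A ∪ B` attaches to two
different vertices of the same side only if `k = 2` and these have no common neighbour on the
other side. -/
structure IsCore (G : SimpleGraph V) (k : ℕ) (A B : Finset V) : Prop extends
    IsIndepPair G A B where
  one_side : ∀ w, ∀ a ∈ A, ∀ b ∈ B, G.Adj w a → ¬ G.Adj w b
  ear_left : ∀ w ∈ outside A B, ∀ w' ∈ outside A B, ∀ a ∈ A, ∀ a' ∈ A, a ≠ a' → G.Adj w w' →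
    G.Adj w a → G.Adj w' a' → k = 2 ∧ ∀ b ∈ B, G.Adj b a → ¬ G.Adj b a'
  ear_right : ∀ w ∈ outside A B, ∀ w' ∈ outside A B, ∀ b ∈ B, ∀ b' ∈ B, b ≠ b' → G.Adj w w' →
    G.Adj w b → G.Adj w' b' → k = 2 ∧ ∀ a ∈ A, G.Adj a b → ¬ G.Adj a b'
  card_left_le : (#A : ℝ) ≤ 0.6 * Fintype.card V
  card_right_le : (#B : ℝ) ≤ 0.6 * Fintype.card V
  card_outside_le : (#(outside A B) : ℝ) ≤ 0.029 * Fintype.card V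
  card_neighborsIn_add_le : ∀ w ∈ outside A B,
    (#(neighborsIn G w A) + #(neighborsIn G w B) : ℝ) ≤ 0.095 * Fintype.card V

theorem IsCore.symm (h : IsCore G k A B) : IsCore G k B A where
  toIsIndepPair := h.toIsIndepPair.symm
  one_side w b hb a ha hwb hwa := h.one_side w a ha b hb hwa hwb
  ear_left := by simpa only [outside_comm B A] using h.ear_right
  ear_right := by simpa only [outside_comm B A] using h.ear_left
  card_left_le := h.card_right_le
  card_right_le := h.card_left_le
  card_outside_le := outside_comm A B ▸ h.card_outside_le
  card_neighborsIn_add_le w hw := by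
    rw [add_comm]
    exact h.card_neighborsIn_add_le w (outside_comm A B ▸ hw)

namespace IsDensePair

theorem ear_heavy (h : IsDensePair G X Y) (hk : 2 ≤ k) (hn : 712 * k ≤ Fintype.card V)
    (hfree : (cycleGraph (2 * k + 1)).Free G) :
    ∀ w ∈ outside (heavy G Y) (heavy G X), ∀ w' ∈ outside (heavy G Y) (heavy G X),
      ∀ a ∈ heavy G Y, ∀ a' ∈ heavy G Y, a ≠ a' → G.Adj w w' → G.Adj w a → G.Adj w' a' →
        k = 2 ∧ ∀ b ∈ heavy G X, G.Adj b a → ¬ G.Adj b a' := by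
  intro w hw w' hw' a ha a' ha' hne hww' hwa hwa'
  rw [mem_outside] at hw hw'
  obtain rfl := h.eq_two_of_ear hk hn hfree ha ha' hne hw.1 hw'.1 hww' hwa hwa'
  exact ⟨rfl, fun b hb hba => not_adj_of_ear_of_free_cycleGraph_five hfree hne
    (ne_of_mem_of_not_mem ha' hw.1).symm (ne_of_mem_of_not_mem ha hw'.1).symm
    (ne_of_mem_of_not_mem hb hw.2) (ne_of_mem_of_not_mem hb hw'.2) hww' hwa hwa' hba⟩

theorem card_heavy_inter_le [DecidableEq V] [Nonempty V] (h : IsDensePair G X Y)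
    (hdisj : Disjoint (heavy G Y) (heavy G X)) :
    (#(heavy G Y ∩ Y) : ℝ) ≤ 0.0145 * Fintype.card V :=
  h.symm.card_le_of_forall_notMem_heavy inter_subset_right fun _ hv =>
    Finset.disjoint_left.mp hdisj (mem_inter.mp hv).1

theorem subset_union_inter [DecidableEq V] (h : IsDensePair G X Y) (S : Finset V) :
    S ⊆ X ∪ S ∩ Y := fun v hv => by
  have := h.mem_or_mem v
  simp only [mem_union, mem_inter]
  tauto

theorem card_heavy_le [Nonempty V] (h : IsDensePair G X Y)
    (hdisj : Disjoint (heavy G Y) (heavy G X)) : (#(heavy G Y) : ℝ) ≤ 0.6 * Fintype.card V := by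
  classical
  have hcard : (#(heavy G Y) : ℝ) ≤ #X + #(heavy G Y ∩ Y) := by
    exact_mod_cast (card_le_card (h.subset_union_inter _)).trans (card_union_le _ _)
  linarith [h.card_left_le, h.card_heavy_inter_le hdisj]

theorem card_neighborsIn_heavy_le [Nonempty V] (h : IsDensePair G X Y)
    (hdisj : Disjoint (heavy G Y) (heavy G X)) (hw : w ∉ heavy G X) :
    (#(neighborsIn G w (heavy G Y)) : ℝ) ≤ 0.095 * Fintype.card V := by
  classical
  have hcard : (#(neighborsIn G w (heavy G Y)) : ℝ) ≤ #(neighborsIn G w X) + #(heavy G Y ∩ Y) := by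
    have hsub :=
      card_le_card (neighborsIn_mono (G := G) (v := w) (h.subset_union_inter (heavy G Y)))
    rw [neighborsIn_union] at hsub
    have := hsub.trans (card_union_le _ _)
    have := card_neighborsIn_le (G := G) (v := w) (S := heavy G Y ∩ Y)
    exact_mod_cast (by omega : #(neighborsIn G w (heavy G Y)) ≤ _)
  linarith [not_le.mp (mem_heavy.not.mp hw), h.card_heavy_inter_le hdisj]

theorem card_outside_heavy_le [Nonempty V] (h : IsDensePair G X Y) :
    (#(outside (heavy G Y) (heavy G X)) : ℝ) ≤ 0.029 * Fintype.card V := by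
  classical
  set Z := outside (heavy G Y) (heavy G X)
  have hX : (#(Z ∩ X) : ℝ) ≤ 0.0145 * Fintype.card V :=
    h.card_le_of_forall_notMem_heavy inter_subset_right fun v hv =>
      (mem_outside.mp (mem_inter.mp hv).1).1
  have hY : (#(Z ∩ Y) : ℝ) ≤ 0.0145 * Fintype.card V :=
    h.symm.card_le_of_forall_notMem_heavy inter_subset_right fun v hv =>
      (mem_outside.mp (mem_inter.mp hv).1).2
  have hZ : (#Z : ℝ) ≤ #(Z ∩ X) + #(Z ∩ Y) := by
    refine mod_cast (card_le_card fun v hv => ?_).trans (card_union_le _ _)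
    simpa [hv] using h.mem_or_mem v
  linarith

theorem isCore (h : IsDensePair G X Y) (hk : 2 ≤ k) (hn : 712 * k ≤ Fintype.card V)
    (hfree : (cycleGraph (2 * k + 1)).Free G) : IsCore G k (heavy G Y) (heavy G X) := by
  have : Nonempty V := Fintype.card_pos_iff.mp (by omega)
  have hdisj := h.disjoint_heavy hk hn hfree
  have hone w a (ha : a ∈ heavy G Y) b (hb : b ∈ heavy G X) :=
    h.not_adj_of_adj_of_mem_heavy (w := w) hk hn hfree ha hb
  exact {
    disjoint := hdisj
    not_adj_left := fun u hu v hv => h.not_adj_of_mem_heavy hk hn hfree hu hv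
    not_adj_right := fun u hu v hv => h.symm.not_adj_of_mem_heavy hk hn hfree hu hv
    one_side := hone
    ear_left := h.ear_heavy hk hn hfree
    ear_right := outside_comm (heavy G Y) (heavy G X) ▸ h.symm.ear_heavy hk hn hfree
    card_left_le := h.card_heavy_le hdisj
    card_right_le := h.symm.card_heavy_le hdisj.symm
    card_outside_le := h.card_outside_heavy_le
    card_neighborsIn_add_le := fun w hw => by
      rw [mem_outside] at hw
      by_cases hA : ∃ a ∈ heavy G Y, G.Adj w a
      · obtain ⟨a, ha, hwa⟩ := hA
        simpa [neighborsIn_eq_empty fun b hb => hone w a ha b hb hwa] using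
          h.card_neighborsIn_heavy_le hdisj hw.2
      · push Not at hA
        simpa [neighborsIn_eq_empty hA] using
          h.symm.card_neighborsIn_heavy_le hdisj.symm hw.1 }

end IsDensePair

end Core

section SubEigenvector

variable {V : Type*} [Fintype V] {G : SimpleGraph V} {k : ℕ} {X : Finset V} {x : V → ℝ} {lam : ℝ}

/-- A nonzero nonnegative vector `x` with `lam • x ≤ A x` entrywise, where `A` is the adjacency
matrix of `G`. The moduli of the entries of an eigenvector form such a vector, which replaces the
Perron eigenvector throughout. -/
structure IsSubEigenvector (G : SimpleGraph V) (x : V → ℝ) (lam : ℝ) : Prop where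
  nonneg : ∀ v, 0 ≤ x v
  exists_pos : ∃ v, 0 < x v
  mul_le : ∀ v, lam * x v ≤ ∑ w ∈ neighborsIn G v univ, x w

namespace IsSubEigenvector

theorem exists_forall_le (h : IsSubEigenvector G x lam) : ∃ u, (∀ v, x v ≤ x u) ∧ 0 < x u := by
  obtain ⟨v, hv⟩ := h.exists_pos
  obtain ⟨u, -, hu⟩ := exists_max_image univ x ⟨v, mem_univ v⟩
  exact ⟨u, fun w => hu w (mem_univ w), hv.trans_le (hu v (mem_univ v))⟩

theorem sq_le_sum_card_neighborsIn (h : IsSubEigenvector G x lam) (hlam : 0 ≤ lam) {u : V}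
    (hmax : ∀ v, x v ≤ x u) (hu : 0 < x u) :
    lam ^ 2 ≤ ∑ v ∈ neighborsIn G u univ, (#(neighborsIn G v univ) : ℝ) := by
  refine le_of_mul_le_mul_right ?_ hu
  calc lam ^ 2 * x u = lam * (lam * x u) := by ring
    _ ≤ lam * ∑ v ∈ neighborsIn G u univ, x v := mul_le_mul_of_nonneg_left (h.mul_le u) hlam
    _ = ∑ v ∈ neighborsIn G u univ, lam * x v := mul_sum _ _ _
    _ ≤ ∑ v ∈ neighborsIn G u univ, #(neighborsIn G v univ) * x u :=
      sum_le_sum fun v _ => (h.mul_le v).trans (sum_neighborsIn_le hmax)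
    _ = _ := (sum_mul _ _ _).symm

end IsSubEigenvector

theorem sum_card_neighborsIn_univ_le [DecidableEq V] (hk : 1 ≤ k)
    (hfree : (cycleGraph (2 * k + 1)).Free G) {u : V} (hX : ∀ v ∈ X, G.Adj u v) :
    ∑ v ∈ X, (#(neighborsIn G v univ) : ℝ) ≤
      4 * k * #X + ∑ v ∈ X, (#(neighborsIn G v Xᶜ) : ℝ) := by
  have hinner : ∑ v ∈ X, #(neighborsIn G v X) ≤ 4 * k * #X :=
    (sum_card_neighborsIn_le_of_forall_adj hk hfree hX).trans (Nat.mul_le_mul_right _ (by omega))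
  have hsplit (v : V) :
      #(neighborsIn G v univ) = #(neighborsIn G v X) + #(neighborsIn G v Xᶜ) := by
    rw [← card_neighborsIn_union disjoint_compl_right, union_compl]
  simp only [hsplit]
  exact_mod_cast sum_add_distrib.trans_le (Nat.add_le_add_right hinner _)

theorem isDensePair_compl [DecidableEq V] (hn : 712 * k ≤ Fintype.card V)
    (hlam : 0.4985 * (Fintype.card V : ℝ) ≤ lam)
    (h : lam ^ 2 ≤ 4 * k * #X + ∑ v ∈ X, (#(neighborsIn G v Xᶜ) : ℝ)) :
    IsDensePair G X Xᶜ := by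
  have hkN : 712 * (k : ℝ) ≤ Fintype.card V := by exact_mod_cast hn
  have hcard : (#X + #Xᶜ : ℝ) = Fintype.card V := by exact_mod_cast card_add_card_compl X
  have hle : ∑ v ∈ X, (#(neighborsIn G v Xᶜ) : ℝ) ≤ #X * #Xᶜ := by
    rw [← nsmul_eq_mul]
    exact sum_le_card_nsmul _ _ _ fun v _ => by exact_mod_cast card_neighborsIn_le
  have hX0 : (0 : ℝ) ≤ #X := Nat.cast_nonneg _
  have hN0 : (0 : ℝ) ≤ Fintype.card V := Nat.cast_nonneg _
  set N : ℝ := (Fintype.card V : ℝ)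
  have hsq : (0.4985 * N) ^ 2 ≤ lam ^ 2 := pow_le_pow_left₀ (by positivity) hlam 2
  have hkX : 712 * k * #X ≤ N * #X := mul_le_mul_of_nonneg_right hkN hX0
  have hcompl : (#Xᶜ : ℝ) = N - #X := by linarith
  have hdev : (#X - N / 2) ^ 2 ≤ (0.085 * N) ^ 2 := by
    rw [hcompl] at hle
    have : N * #X ≤ N * N := mul_le_mul_of_nonneg_left (by linarith) hN0
    nlinarith
  obtain ⟨hlow, hhigh⟩ := abs_le.mp (abs_le_of_sq_le_sq hdev (by positivity))
  refine ⟨disjoint_compl_right, fun v => ?_, by linarith, by linarith, ?_⟩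
  · rw [mem_compl]
    exact em _
  · have : N * #X ≤ N * (0.585 * N) := mul_le_mul_of_nonneg_left (by linarith) hN0
    rw [hcompl]
    nlinarith [sq_nonneg (#X - N / 2)]

theorem IsSubEigenvector.exists_isDensePair (h : IsSubEigenvector G x lam) (hk : 1 ≤ k)
    (hn : 712 * k ≤ Fintype.card V) (hfree : (cycleGraph (2 * k + 1)).Free G)
    (hlam : 0.4985 * (Fintype.card V : ℝ) ≤ lam) : ∃ X Y, IsDensePair G X Y := by
  classical
  obtain ⟨u, hmax, hu⟩ := h.exists_forall_le
  have hlam0 : 0 ≤ lam := le_trans (by positivity) hlam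
  exact ⟨_, _, isDensePair_compl hn hlam <|
    (h.sq_le_sum_card_neighborsIn hlam0 hmax hu).trans <|
      sum_card_neighborsIn_univ_le hk hfree (u := u) fun v hv => (mem_neighborsIn.mp hv).2⟩

end SubEigenvector

section CoreWeights

variable {V : Type*} [Fintype V] {G : SimpleGraph V} {k : ℕ} {A B S : Finset V} {x : V → ℝ}
  {lam : ℝ} {u w : V}

namespace IsIndepPair

theorem mul_le_of_mem_left (h : IsIndepPair G A B) (hx : IsSubEigenvector G x lam) (hw : w ∈ A) :
    lam * x w ≤ ∑ v ∈ neighborsIn G w B, x v + ∑ v ∈ neighborsIn G w (outside A B), x v := by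
  refine (hx.mul_le w).trans_eq ?_
  rw [sum_neighborsIn_univ h.disjoint, neighborsIn_eq_empty (h.not_adj_left w hw), sum_empty,
    zero_add]

theorem mul_sum_left_le (h : IsIndepPair G A B) (hx : IsSubEigenvector G x lam) :
    lam * ∑ a ∈ A, x a ≤
      ∑ b ∈ B, #(neighborsIn G b A) * x b + ∑ w ∈ outside A B, #(neighborsIn G w A) * x w := by
  simp only [← nsmul_eq_mul]
  rw [mul_sum, ← sum_sum_neighborsIn, ← sum_sum_neighborsIn, ← sum_add_distrib]
  exact sum_le_sum fun a ha => h.mul_le_of_mem_left hx ha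

theorem mul_sum_left_le_of_card_le (h : IsIndepPair G A B) (hx : IsSubEigenvector G x lam) {p : ℕ}
    (hp : ∀ b ∈ B, #(neighborsIn G b A) ≤ p) :
    lam * ∑ a ∈ A, x a ≤ p * ∑ b ∈ B, x b + ∑ w ∈ outside A B, #(neighborsIn G w A) * x w := by
  refine (h.mul_sum_left_le hx).trans (add_le_add_left ?_ _)
  rw [mul_sum]
  exact sum_le_sum fun b hb =>
    mul_le_mul_of_nonneg_right (by exact_mod_cast hp b hb) (hx.nonneg b)

end IsIndepPair

namespace IsCore

theorem le_div_four_of_mem_outside (h : IsCore G k A B) (hx : IsSubEigenvector G x lam)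
    (hlam : 0.4985 * (Fintype.card V : ℝ) ≤ lam) {M : ℝ} (hM : ∀ v, x v ≤ M)
    (hw : w ∈ outside A B) : x w ≤ M / 4 := by
  have hM0 : 0 ≤ M := (hx.nonneg w).trans (hM w)
  have hout : (#(neighborsIn G w (outside A B)) : ℝ) ≤ #(outside A B) := by
    exact_mod_cast card_neighborsIn_le
  have hN : (0 : ℝ) < Fintype.card V := by exact_mod_cast Fintype.card_pos_iff.mpr ⟨w⟩
  refine le_of_mul_le_mul_left ?_ hN
  have hle := calc
    0.4985 * (Fintype.card V : ℝ) * x w ≤ lam * x w :=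
      mul_le_mul_of_nonneg_right hlam (hx.nonneg w)
    _ ≤ _ := hx.mul_le w
    _ ≤ (#(neighborsIn G w A) + #(neighborsIn G w B) +
          #(neighborsIn G w (outside A B)) : ℝ) * M := by
      rw [sum_neighborsIn_univ h.disjoint, add_mul, add_mul]
      gcongr <;> exact sum_neighborsIn_le hM
    _ ≤ 0.124 * Fintype.card V * M :=
      mul_le_mul_of_nonneg_right
        (by linarith [h.card_neighborsIn_add_le w hw, h.card_outside_le]) hM0
  linarith [mul_nonneg hN.le hM0]

theorem sum_outside_le (h : IsCore G k A B) (hx : IsSubEigenvector G x lam)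
    (hlam : 0.4985 * (Fintype.card V : ℝ) ≤ lam) {M : ℝ} (hM0 : 0 ≤ M) (hM : ∀ v, x v ≤ M) :
    ∑ w ∈ outside A B, x w ≤ 0.00725 * Fintype.card V * M := by
  calc ∑ w ∈ outside A B, x w ≤ #(outside A B) * (M / 4) := by
        rw [← nsmul_eq_mul]
        exact sum_le_card_nsmul _ _ _ fun w hw => h.le_div_four_of_mem_outside hx hlam hM hw
    _ ≤ 0.029 * Fintype.card V * (M / 4) :=
      mul_le_mul_of_nonneg_right h.card_outside_le (by positivity)
    _ = _ := by ring

theorem sum_card_neighborsIn_left_mul_le (h : IsCore G k A B) (hx : IsSubEigenvector G x lam)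
    (hlam : 0.4985 * (Fintype.card V : ℝ) ≤ lam) {M : ℝ} (hM : ∀ v, x v ≤ M)
    (hS : S ⊆ outside A B) :
    ∑ w ∈ S, #(neighborsIn G w A) * x w ≤ #S * (0.02375 * Fintype.card V * M) := by
  rw [← nsmul_eq_mul]
  refine sum_le_card_nsmul _ _ _ fun w hw => ?_
  have hcard : (#(neighborsIn G w A) : ℝ) ≤ 0.095 * Fintype.card V :=
    (le_add_of_nonneg_right (Nat.cast_nonneg _)).trans (h.card_neighborsIn_add_le w (hS hw))
  calc (#(neighborsIn G w A) : ℝ) * x w ≤ (0.095 * Fintype.card V) * (M / 4) :=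
        mul_le_mul hcard (h.le_div_four_of_mem_outside hx hlam hM (hS hw)) (hx.nonneg w)
          (by positivity)
    _ = _ := by ring

theorem le_sum_right_of_mem_left (h : IsCore G k A B) (hx : IsSubEigenvector G x lam)
    (hlam : 0.4985 * (Fintype.card V : ℝ) ≤ lam) (hmax : ∀ v, x v ≤ x u) (hu : u ∈ A) :
    0.49 * Fintype.card V * x u ≤ ∑ b ∈ B, x b := by
  have hmul := h.mul_le_of_mem_left hx hu
  have hB := sum_neighborsIn_le_sum (G := G) (v := u) (S := B) hx.nonneg
  have hout := sum_neighborsIn_le_sum (G := G) (v := u) (S := outside A B) hx.nonneg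
  have hlamu := mul_le_mul_of_nonneg_right hlam (hx.nonneg u)
  have := h.sum_outside_le hx hlam (hx.nonneg u) hmax
  linarith [mul_nonneg (Nat.cast_nonneg (Fintype.card V) : (0 : ℝ) ≤ _) (hx.nonneg u)]

theorem le_sum_left_of_mem_left (h : IsCore G k A B) (hx : IsSubEigenvector G x lam)
    (hlam : 0.4985 * (Fintype.card V : ℝ) ≤ lam) (hmax : ∀ v, x v ≤ x u) (hu : u ∈ A) :
    0.4 * Fintype.card V * x u ≤ ∑ a ∈ A, x a := by
  have hmul := h.toIsIndepPair.symm.mul_sum_left_le_of_card_le hx (p := #B)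
    fun a _ => card_neighborsIn_le
  have hout := h.symm.sum_card_neighborsIn_left_mul_le hx hlam hmax subset_rfl
  have hB := h.le_sum_right_of_mem_left hx hlam hmax hu
  have hA0 : 0 ≤ ∑ a ∈ A, x a := sum_nonneg fun v _ => hx.nonneg v
  have hN : (0 : ℝ) < Fintype.card V := by exact_mod_cast Fintype.card_pos_iff.mpr ⟨u⟩
  have hNu : 0 ≤ Fintype.card V * x u := mul_nonneg hN.le (hx.nonneg u)
  have hlower : 0.4985 * Fintype.card V * (0.49 * Fintype.card V * x u) ≤ lam * ∑ b ∈ B, x b :=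
    mul_le_mul hlam hB (by linarith) (by linarith)
  have hcardB := mul_le_mul_of_nonneg_right h.card_right_le hA0
  have hcardOut := mul_le_mul_of_nonneg_right h.symm.card_outside_le
    (by linarith : 0 ≤ 0.02375 * Fintype.card V * x u)
  refine le_of_mul_le_mul_left ?_ hN
  nlinarith [mul_nonneg hN.le hNu]

theorem le_sum_left_and_le_sum_right (h : IsCore G k A B) (hx : IsSubEigenvector G x lam)
    (hlam : 0.4985 * (Fintype.card V : ℝ) ≤ lam) (hmax : ∀ v, x v ≤ x u) (hu : 0 < x u) :
    0.4 * Fintype.card V * x u ≤ ∑ a ∈ A, x a ∧ 0.4 * Fintype.card V * x u ≤ ∑ b ∈ B, x b := by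
  have hweaken {s : ℝ} (hs : 0.49 * Fintype.card V * x u ≤ s) : 0.4 * Fintype.card V * x u ≤ s :=
    le_trans (by gcongr; norm_num) hs
  by_cases hA : u ∈ A
  · exact ⟨h.le_sum_left_of_mem_left hx hlam hmax hA,
      hweaken (h.le_sum_right_of_mem_left hx hlam hmax hA)⟩
  by_cases hB : u ∈ B
  · exact ⟨hweaken (h.symm.le_sum_right_of_mem_left hx hlam hmax hB),
      h.symm.le_sum_left_of_mem_left hx hlam hmax hB⟩
  linarith [h.le_div_four_of_mem_outside hx hlam hmax (mem_outside.mpr ⟨hA, hB⟩)]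

theorem two_mul_le (h : IsCore G k A B) (hx : IsSubEigenvector G x lam)
    (hlam : 0.4985 * (Fintype.card V : ℝ) ≤ lam) (hmax : ∀ v, x v ≤ x u) (hu : 0 < x u)
    {p q : ℕ} (hp : ∀ b ∈ B, #(neighborsIn G b A) ≤ p) (hq : ∀ a ∈ A, #(neighborsIn G a B) ≤ q)
    {ε : ℝ} (hε : 0 ≤ ε)
    (hεA : ∑ w ∈ outside A B, #(neighborsIn G w A) * x w ≤ ε * (0.4 * Fintype.card V * x u))
    (hεB : ∑ w ∈ outside A B, #(neighborsIn G w B) * x w ≤ ε * (0.4 * Fintype.card V * x u)) :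
    2 * lam ≤ p + q + 2 * ε := by
  obtain ⟨hA, hB⟩ := h.le_sum_left_and_le_sum_right hx hlam hmax hu
  have hN : (0 : ℝ) < Fintype.card V := by exact_mod_cast Fintype.card_pos_iff.mpr ⟨u⟩
  have hlam0 : 0 ≤ lam := le_trans (by positivity) hlam
  have hpos : 0 < 0.4 * (Fintype.card V : ℝ) * x u := by positivity
  have hlamA : lam * ∑ a ∈ A, x a ≤ (p + ε) * ∑ b ∈ B, x b := by
    have := h.mul_sum_left_le_of_card_le hx hp
    linarith [mul_le_mul_of_nonneg_left hB hε]
  have hlamB : lam * ∑ b ∈ B, x b ≤ (q + ε) * ∑ a ∈ A, x a := by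
    have := h.toIsIndepPair.symm.mul_sum_left_le_of_card_le hx hq
    rw [outside_comm B A] at this
    linarith [mul_le_mul_of_nonneg_left hA hε]
  have hprod : lam ^ 2 ≤ (p + ε) * (q + ε) := by
    have hAB : 0 < (∑ a ∈ A, x a) * ∑ b ∈ B, x b :=
      mul_pos (hpos.trans_le hA) (hpos.trans_le hB)
    refine le_of_mul_le_mul_right ?_ hAB
    have := mul_le_mul hlamA hlamB (mul_nonneg hlam0 (hpos.le.trans hB))
      (mul_nonneg (by positivity) (hpos.le.trans hB))
    linarith
  exact (abs_le_of_sq_le_sq' (by nlinarith [sq_nonneg ((p : ℝ) - q)]) (by positivity)).2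

end IsCore

open Classical in
/-- The vertices outside `A ∪ B` with at most one neighbour in `A ∪ B`. -/
noncomputable def outsideLow (G : SimpleGraph V) (A B : Finset V) : Finset V :=
  {w ∈ outside A B | #(neighborsIn G w A) + #(neighborsIn G w B) ≤ 1}

open Classical in
/-- The vertices outside `A ∪ B` with at least two neighbours in `A ∪ B`. -/
noncomputable def outsideHigh (G : SimpleGraph V) (A B : Finset V) : Finset V :=
  {w ∈ outside A B | ¬ #(neighborsIn G w A) + #(neighborsIn G w B) ≤ 1}

theorem mem_outsideLow : w ∈ outsideLow G A B ↔
    w ∈ outside A B ∧ #(neighborsIn G w A) + #(neighborsIn G w B) ≤ 1 := by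
  simp [outsideLow]

theorem mem_outsideHigh : w ∈ outsideHigh G A B ↔
    w ∈ outside A B ∧ ¬ #(neighborsIn G w A) + #(neighborsIn G w B) ≤ 1 := by
  simp [outsideHigh]

theorem outsideHigh_comm : outsideHigh G A B = outsideHigh G B A := by
  ext w
  rw [mem_outsideHigh, mem_outsideHigh, outside_comm, add_comm]

theorem sum_outsideLow_add_sum_outsideHigh {M : Type*} [AddCommMonoid M] (f : V → M) :
    ∑ w ∈ outsideLow G A B, f w + ∑ w ∈ outsideHigh G A B, f w = ∑ w ∈ outside A B, f w :=
  sum_filter_add_sum_filter_not _ _ _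

theorem card_outsideLow_add_card_outsideHigh :
    #(outsideLow G A B) + #(outsideHigh G A B) = #(outside A B) :=
  card_filter_add_card_filter_not _

namespace IsCore

theorem sum_outside_card_neighborsIn_left_mul_le (h : IsCore G k A B)
    (hx : IsSubEigenvector G x lam) (hlam : 0.4985 * (Fintype.card V : ℝ) ≤ lam)
    (hmax : ∀ v, x v ≤ x u) :
    ∑ w ∈ outside A B, #(neighborsIn G w A) * x w ≤
      (#(outsideHigh G A B) / 16 + 0.0182) * (0.4 * Fintype.card V * x u) := by
  have hu := hx.nonneg u
  have hhigh := h.sum_card_neighborsIn_left_mul_le hx hlam hmax (S := outsideHigh G A B)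
    (filter_subset _ _)
  have hlow : ∑ w ∈ outsideLow G A B, #(neighborsIn G w A) * x w ≤
      0.00725 * Fintype.card V * x u := by
    refine le_trans ?_ (h.sum_outside_le hx hlam hu hmax)
    refine (sum_le_sum fun w hw => ?_).trans
      (sum_le_sum_of_subset_of_nonneg (filter_subset _ _) fun w _ _ => hx.nonneg w)
    have hone : #(neighborsIn G w A) ≤ 1 := by have := (mem_outsideLow.mp hw).2; omega
    exact mul_le_of_le_one_left (hx.nonneg w) (by exact_mod_cast hone)
  rw [← sum_outsideLow_add_sum_outsideHigh (G := G)]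
  have hNu : 0 ≤ Fintype.card V * x u := by positivity
  have : 0 ≤ #(outsideHigh G A B) * (Fintype.card V * x u) := by positivity
  linarith

theorem weighted_card_outside_le (h : IsCore G k A B) (hx : IsSubEigenvector G x lam)
    (hlam : 0.4985 * (Fintype.card V : ℝ) ≤ lam) (hN : 10 ≤ Fintype.card V) {c p q e : ℕ}
    (hc : (Fintype.card V - c : ℝ) ^ 2 - 1 ≤ 4 * lam ^ 2)
    (hp : ∀ b ∈ B, #(neighborsIn G b A) ≤ p) (hq : ∀ a ∈ A, #(neighborsIn G a B) ≤ q)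
    (he : p + q + e ≤ #A + #B) :
    8 * #(outsideLow G A B) + 7 * #(outsideHigh G A B) + 8 * e ≤ 8 * c := by
  obtain ⟨u, hmax, hu⟩ := hx.exists_forall_le
  have hB := h.symm.sum_outside_card_neighborsIn_left_mul_le hx hlam hmax
  rw [outside_comm, outsideHigh_comm] at hB
  have htwo := h.two_mul_le hx hlam hmax hu hp hq (by positivity)
    (h.sum_outside_card_neighborsIn_left_mul_le hx hlam hmax) hB
  have hcard : (p + q + e + #(outsideLow G A B) + #(outsideHigh G A B) : ℝ) ≤ Fintype.card V := by
    have := card_outsideLow_add_card_outsideHigh (G := G) (A := A) (B := B)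
    have := card_add_card_add_card_outside h.disjoint
    exact_mod_cast (by omega : p + q + e + #(outsideLow G A B) + #(outsideHigh G A B) ≤ _)
  by_contra! hlt
  have hlt' : (8 * c + 1 : ℝ) ≤ 8 * #(outsideLow G A B) + 7 * #(outsideHigh G A B) + 8 * e := by
    exact_mod_cast hlt
  have : (10 : ℝ) ≤ Fintype.card V := by exact_mod_cast hN
  nlinarith

end IsCore

end CoreWeights

section Coloring

variable {V : Type*} {G : SimpleGraph V} {A B S : Finset V} {f : V → Bool} {a : V}

theorem colorable_card_add_two (T : Finset V) (g : V → Bool)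
    (hg : ∀ u v, u ∉ T → v ∉ T → G.Adj u v → g u ≠ g v) : G.Colorable (#T + 2) := by
  classical
  let coloring : G.Coloring (T ⊕ Bool) := Coloring.mk
    (fun v => if h : v ∈ T then .inl ⟨v, h⟩ else .inr (g v)) (by
      intro u v huv
      by_cases hu : u ∈ T <;> by_cases hv : v ∈ T <;> simp only [hu, hv, dite_true, dite_false]
      · simpa using huv.ne
      · simp
      · simp
      · simpa using hg u v hu hv huv)
  simpa using coloring.colorable

/-- A proper 2-colouring `f` of `S` that extends to `A ∪ B` by giving `A` the colour `false` and
`B` the colour `true`. -/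
structure IsBicoloring (G : SimpleGraph V) (A B S : Finset V) (f : V → Bool) : Prop where
  left : ∀ w ∈ S, ∀ a ∈ A, G.Adj w a → f w = true
  right : ∀ w ∈ S, ∀ b ∈ B, G.Adj w b → f w = false
  proper : ∀ w ∈ S, ∀ w' ∈ S, G.Adj w w' → f w ≠ f w'

theorem IsBicoloring.colorable [Fintype V] [DecidableEq V] (hf : IsBicoloring G A B S f)
    (h : IsIndepPair G A B) : G.Colorable (#(outside A B \ S) + 2) := by
  let g : V → Bool := fun v => if v ∈ A then false else if v ∈ B then true else f v
  have gA {v} (hv : v ∈ A) : g v = false := if_pos hv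
  have gB {v} (hv : v ∈ B) : g v = true := by
    simp [g, hv, disjoint_right.mp h.disjoint hv]
  have gS {v} (hA : v ∉ A) (hB : v ∉ B) : g v = f v := by simp [g, hA, hB]
  have hmemS {v} (hv : v ∉ outside A B \ S) (hA : v ∉ A) (hB : v ∉ B) : v ∈ S := by
    by_contra hvS
    exact hv (mem_sdiff.mpr ⟨mem_outside.mpr ⟨hA, hB⟩, hvS⟩)
  have core_ne {u v} (hv : v ∉ outside A B \ S) (huv : G.Adj u v) (hu : u ∈ A ∨ u ∈ B) :
      g u ≠ g v := by
    rcases hu with hu | hu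
    · have hvA : v ∉ A := fun hvA => h.not_adj_left u hu v hvA huv
      by_cases hvB : v ∈ B
      · simp [gA hu, gB hvB]
      · simp [gA hu, gS hvA hvB, hf.left v (hmemS hv hvA hvB) u hu huv.symm]
    · have hvB : v ∉ B := fun hvB => h.not_adj_right u hu v hvB huv
      by_cases hvA : v ∈ A
      · simp [gA hvA, gB hu]
      · simp [gB hu, gS hvA hvB, hf.right v (hmemS hv hvA hvB) u hu huv.symm]
  refine colorable_card_add_two _ g fun u v hu hv huv => ?_
  by_cases hu' : u ∈ A ∨ u ∈ B
  · exact core_ne hv huv hu'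
  by_cases hv' : v ∈ A ∨ v ∈ B
  · exact (core_ne hu huv.symm hv').symm
  push Not at hu' hv'
  rw [gS hu'.1 hu'.2, gS hv'.1 hv'.2]
  exact hf.proper u (hmemS hu hu'.1 hu'.2) v (hmemS hv hv'.1 hv'.2) huv

theorem IsBicoloring.le_card_add_one [Fintype V] {c : ℕ}
    (hf : IsBicoloring G A B S f) (h : IsIndepPair G A B)
    (hchi : ((c + 1 : ℕ) : ℕ∞) ≤ G.chromaticNumber) (hS : S ⊆ outside A B) :
    c + #S ≤ #(outside A B) + 1 := by
  classical
  have hle : c + 1 ≤ #(outside A B \ S) + 2 := by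
    exact_mod_cast hchi.trans (hf.colorable h).chromaticNumber_le
  have := card_sdiff_add_card_eq_card hS
  omega

/-- The vertices outside `A ∪ B` form a clique which `a ∈ A` joins to the independent sets `A` and
`B`: no further edge leaves that clique. -/
structure IsBipartiteWithClique [Fintype V] (G : SimpleGraph V) (A B : Finset V) (a : V) : Prop
    extends IsIndepPair G A B where
  mem_left : a ∈ A
  adj_iff : ∀ z ∈ outside A B, ∀ v, G.Adj z v ↔ v = a ∨ v ∈ outside A B ∧ z ≠ v

end Coloring

section CliqueOutside

variable {V : Type*} [Fintype V] {G : SimpleGraph V} {k c : ℕ} {A B S : Finset V} {x : V → ℝ}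
  {lam : ℝ} {w w' : V}

/-- Adjacent vertices outside `A ∪ B` have no two different neighbours in `A`. -/
def NoEar (G : SimpleGraph V) (A B : Finset V) : Prop :=
  ∀ w ∈ outside A B, ∀ w' ∈ outside A B, ∀ a ∈ A, ∀ a' ∈ A,
    G.Adj w w' → G.Adj w a → G.Adj w' a' → a = a'

namespace IsCore

theorem exists_isBicoloring (h : IsCore G k A B)
    (hS : ∀ w ∈ S, ∀ w' ∈ S, G.Adj w w' →
      ((∃ a ∈ A, G.Adj w a) ↔ ¬ ∃ a ∈ A, G.Adj w' a)) :
    ∃ f, IsBicoloring G A B S f := by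
  classical
  refine ⟨fun w => decide (∃ a ∈ A, G.Adj w a), ?_, ?_, ?_⟩
  · exact fun w _ a ha hwa => decide_eq_true ⟨a, ha, hwa⟩
  · exact fun w _ b hb hwb =>
      decide_eq_false fun ⟨a, ha, hwa⟩ => h.one_side w a ha b hb hwa hwb
  · intro w hw w' hw' hww'
    by_cases hw'A : ∃ a ∈ A, G.Adj w' a <;> simp [hw'A, hS w hw w' hw' hww']

theorem exists_isBicoloring_singleton (h : IsCore G k A B) (w : V) :
    ∃ f, IsBicoloring G A B {w} f := by
  refine h.exists_isBicoloring fun u hu v hv huv => ?_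
  rw [mem_singleton.mp hu, mem_singleton.mp hv] at huv
  exact absurd huv G.irrefl

theorem noEar (h : IsCore G k A B) (hx : IsSubEigenvector G x lam)
    (hlam : 0.4985 * (Fintype.card V : ℝ) ≤ lam) (hN : 10 ≤ Fintype.card V) (hck : c < 2 * k)
    (hc : (Fintype.card V - c : ℝ) ^ 2 - 1 ≤ 4 * lam ^ 2)
    (hchi : ((c + 1 : ℕ) : ℕ∞) ≤ G.chromaticNumber) : NoEar G A B := by
  classical
  intro w hw w' hw' a ha a' ha' hww' hwa hwa'
  by_contra hne
  obtain ⟨rfl, hnot⟩ := h.ear_left w hw w' hw' a ha a' ha' hne hww' hwa hwa'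
  have hmiss : ∀ b ∈ B, #(neighborsIn G b A) ≤ #A - 1 := by
    intro b hb
    refine Nat.le_sub_one_of_lt ?_
    by_cases hba : G.Adj b a
    · exact card_neighborsIn_lt ha' (hnot b hb hba)
    · exact card_neighborsIn_lt ha hba
  have hApos : 0 < #A := card_pos.mpr ⟨a, ha⟩
  have hweight := h.weighted_card_outside_le hx hlam hN hc hmiss (q := #B) (e := 1)
    (fun _ _ => card_neighborsIn_le) (by omega)
  have hsum := card_outsideLow_add_card_outsideHigh (G := G) (A := A) (B := B)
  have : 1 < #(outside A B) := one_lt_card.mpr ⟨w, hw, w', hw', hww'.ne⟩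
  obtain ⟨f, hf⟩ := h.exists_isBicoloring_singleton w
  have := hf.le_card_add_one h.toIsIndepPair hchi (singleton_subset_iff.mpr hw)
  rw [card_singleton] at this
  omega

theorem exists_one_lt_card_neighborsIn_of_mem_outsideHigh (h : IsCore G k A B)
    (hw : w ∈ outsideHigh G A B) : 1 < #(neighborsIn G w A) ∨ 1 < #(neighborsIn G w B) := by
  have hside : ¬ (0 < #(neighborsIn G w A) ∧ 0 < #(neighborsIn G w B)) := by
    rw [card_neighborsIn_pos, card_neighborsIn_pos]
    rintro ⟨⟨a, ha, hwa⟩, b, hb, hwb⟩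
    exact h.one_side w a ha b hb hwa hwb
  have := (mem_outsideHigh.mp hw).2
  omega

end IsCore

theorem NoEar.not_adj_of_one_lt_card (h : NoEar G A B) (hw : w ∈ outside A B)
    (hw' : w' ∈ outside A B) (hone : 1 < #(neighborsIn G w A)) (hww' : G.Adj w w') :
    ∀ a ∈ A, ¬ G.Adj w' a := by
  intro a ha hwa'
  obtain ⟨a', ha', hne⟩ := exists_mem_ne hone a
  rw [mem_neighborsIn] at ha'
  exact hne (h w hw w' hw' a' ha'.1 a ha hww' ha'.2 hwa')

namespace IsCore

theorem exists_isBicoloring_outsideHigh (h : IsCore G k A B) (hA : NoEar G A B)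
    (hB : NoEar G B A) : ∃ f, IsBicoloring G A B (outsideHigh G A B) f := by
  refine h.exists_isBicoloring fun w hw w' hw' hww' => ?_
  have hout := (mem_outsideHigh.mp hw).1
  have hout' := (mem_outsideHigh.mp hw').1
  rcases h.exists_one_lt_card_neighborsIn_of_mem_outsideHigh hw with hone | hone
  · refine iff_of_true (card_neighborsIn_pos.mp (zero_lt_one.trans hone)) ?_
    rintro ⟨a, ha, hwa'⟩
    exact hA.not_adj_of_one_lt_card hout hout' hone hww' a ha hwa'
  · rw [outside_comm] at hout hout'
    have hnot' := hB.not_adj_of_one_lt_card hout hout' hone hww'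
    obtain ⟨b, hb, hwb⟩ := card_neighborsIn_pos.mp (zero_lt_one.trans hone)
    refine iff_of_false (fun ⟨a, ha, hwa⟩ => h.one_side w a ha b hb hwa hwb) (not_not.mpr ?_)
    rcases h.exists_one_lt_card_neighborsIn_of_mem_outsideHigh hw' with hone' | hone'
    · exact card_neighborsIn_pos.mp (zero_lt_one.trans hone')
    · obtain ⟨b', hb', hwb'⟩ := card_neighborsIn_pos.mp (zero_lt_one.trans hone')
      exact absurd hwb' (hnot' b' hb')

theorem card_outside_eq (h : IsCore G k A B) (hA : NoEar G A B) (hB : NoEar G B A)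
    (hx : IsSubEigenvector G x lam) (hlam : 0.4985 * (Fintype.card V : ℝ) ≤ lam)
    (hN : 10 ≤ Fintype.card V) (hc2 : 2 ≤ c)
    (hc : (Fintype.card V - c : ℝ) ^ 2 - 1 ≤ 4 * lam ^ 2)
    (hchi : ((c + 1 : ℕ) : ℕ∞) ≤ G.chromaticNumber) : #(outside A B) = c := by
  classical
  have hsum := card_outsideLow_add_card_outsideHigh (G := G) (A := A) (B := B)
  have hweight := h.weighted_card_outside_le hx hlam hN hc (p := #A) (q := #B) (e := 0)
    (fun _ _ => card_neighborsIn_le) (fun _ _ => card_neighborsIn_le) le_rfl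
  obtain ⟨f, hf⟩ := h.exists_isBicoloring_outsideHigh hA hB
  have hhigh := hf.le_card_add_one h.toIsIndepPair hchi (filter_subset _ _)
  obtain ⟨w, hw⟩ : (outside A B).Nonempty := card_pos.mp (by omega)
  obtain ⟨g, hg⟩ := h.exists_isBicoloring_singleton w
  have hsingle := hg.le_card_add_one h.toIsIndepPair hchi (singleton_subset_iff.mpr hw)
  rw [card_singleton] at hsingle
  omega

theorem adj_of_forall_not_isBicoloring (h : IsCore G k A B)
    (hcrit : ∀ S ⊆ outside A B, 1 < #S → ∀ f, ¬ IsBicoloring G A B S f)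
    (hw : w ∈ outside A B) (hw' : w' ∈ outside A B) (hne : w ≠ w') : G.Adj w w' := by
  classical
  by_contra hnot
  obtain ⟨f, hf⟩ := h.exists_isBicoloring (S := {w, w'}) fun u hu v hv huv => by
    rw [mem_insert, mem_singleton] at hu hv
    rcases hu with rfl | rfl <;> rcases hv with rfl | rfl
    exacts [absurd huv G.irrefl, absurd huv hnot, absurd huv.symm hnot, absurd huv G.irrefl]
  have hS : {w, w'} ⊆ outside A B := insert_subset hw (singleton_subset_iff.mpr hw')
  exact hcrit _ hS (card_pair hne).ge f hf

end IsCore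

theorem exists_adj_left_or_exists_adj_right
    (hcrit : ∀ S ⊆ outside A B, 1 < #S → ∀ f, ¬ IsBicoloring G A B S f)
    (hw : w ∈ outside A B) (hw' : w' ∈ outside A B) (hne : w ≠ w') :
    (∃ a ∈ A, G.Adj w a) ∨ ∃ b ∈ B, G.Adj w' b := by
  classical
  by_contra! hnot
  have hS : {w, w'} ⊆ outside A B := insert_subset hw (singleton_subset_iff.mpr hw')
  refine hcrit _ hS (card_pair hne).ge (fun v => decide (v = w')) ⟨?_, ?_, ?_⟩ <;>
    simp only [mem_insert, mem_singleton]
  · rintro v (rfl | rfl) a ha hva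
    exacts [absurd hva (hnot.1 a ha), decide_eq_true rfl]
  · rintro v (rfl | rfl) b hb hvb
    exacts [decide_eq_false hne, absurd hvb (hnot.2 b hb)]
  · rintro u (rfl | rfl) v (rfl | rfl) huv
    exacts [absurd huv G.irrefl, by simp [hne], by simp [hne], absurd huv G.irrefl]

namespace IsCore

theorem forall_exists_adj_left_or_right (h : IsCore G k A B)
    (hcrit : ∀ S ⊆ outside A B, 1 < #S → ∀ f, ¬ IsBicoloring G A B S f)
    (hout : 1 < #(outside A B)) :
    (∀ w ∈ outside A B, ∃ a ∈ A, G.Adj w a) ∨ ∀ w ∈ outside A B, ∃ b ∈ B, G.Adj w b := by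
  rw [or_iff_not_imp_left]
  intro hnot
  push Not at hnot
  obtain ⟨z, hz, hzA⟩ := hnot
  have hzA : ¬ ∃ a ∈ A, G.Adj z a := by simpa using hzA
  have hright {w : V} (hw : w ∈ outside A B) (hne : w ≠ z) : ∃ b ∈ B, G.Adj w b :=
    (exists_adj_left_or_exists_adj_right hcrit hz hw hne.symm).resolve_left hzA
  intro w hw
  rcases ne_or_eq w z with hne | rfl
  · exact hright hw hne
  · obtain ⟨y, hy, hne⟩ := exists_mem_ne hout w
    obtain ⟨b, hb, hyb⟩ := hright hy hne
    exact (exists_adj_left_or_exists_adj_right hcrit hy hz hne).resolve_left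
      fun ⟨a, ha, hya⟩ => h.one_side y a ha b hb hya hyb

theorem exists_isBipartiteWithClique_of_forall_exists_adj (h : IsCore G k A B)
    (hA : NoEar G A B) (hclique : ∀ z ∈ outside A B, ∀ z' ∈ outside A B, z ≠ z' → G.Adj z z')
    (hout : 1 < #(outside A B)) (hleft : ∀ z ∈ outside A B, ∃ a ∈ A, G.Adj z a) :
    ∃ a, IsBipartiteWithClique G A B a := by
  obtain ⟨z, hz⟩ : (outside A B).Nonempty := card_pos.mp (by omega)
  obtain ⟨a, ha, hza⟩ := hleft z hz
  have huniq {y v : V} (hy : y ∈ outside A B) (hne : y ≠ z) (hv : v ∈ A) (hyv : G.Adj y v) :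
      v = a :=
    hA y hy z hz v hv a ha (hclique y hy z hz hne) hyv hza
  obtain ⟨y, hy, hne⟩ := exists_mem_ne hout z
  have hadj {w v : V} (hw : w ∈ outside A B) (hv : v ∈ A) (hwv : G.Adj w v) : v = a := by
    rcases ne_or_eq w z with hwz | rfl
    · exact huniq hw hwz hv hwv
    · obtain ⟨a', ha', hya'⟩ := hleft y hy
      exact (hA w hw y hy v hv a' ha' (hclique w hw y hy hne.symm) hwv hya').trans
        (huniq hy hne ha' hya')
  refine ⟨a, h.toIsIndepPair, ha, fun w hw v => ⟨fun hwv => ?_, ?_⟩⟩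
  · by_cases hvA : v ∈ A
    · exact .inl (hadj hw hvA hwv)
    · obtain ⟨a', ha', hwa'⟩ := hleft w hw
      exact .inr ⟨mem_outside.mpr ⟨hvA, fun hvB => h.one_side w a' ha' v hvB hwa' hwv⟩, hwv.ne⟩
  · rintro (rfl | ⟨hv, hwv⟩)
    · obtain ⟨a', ha', hwa'⟩ := hleft w hw
      exact hadj hw ha' hwa' ▸ hwa'
    · exact hclique w hw v hv hwv

theorem exists_isBipartiteWithClique (h : IsCore G k A B) (hx : IsSubEigenvector G x lam)
    (hlam : 0.4985 * (Fintype.card V : ℝ) ≤ lam) (hN : 10 ≤ Fintype.card V) (hc2 : 2 ≤ c)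
    (hck : c < 2 * k) (hc : (Fintype.card V - c : ℝ) ^ 2 - 1 ≤ 4 * lam ^ 2)
    (hchi : ((c + 1 : ℕ) : ℕ∞) ≤ G.chromaticNumber) :
    ∃ A' B' a, IsBipartiteWithClique G A' B' a ∧ #(outside A' B') = c := by
  have hA := h.noEar hx hlam hN hck hc hchi
  have hB := h.symm.noEar hx hlam hN hck hc hchi
  have hcard := h.card_outside_eq hA hB hx hlam hN hc2 hc hchi
  have hcrit : ∀ S ⊆ outside A B, 1 < #S → ∀ f, ¬ IsBicoloring G A B S f := by
    intro S hS hone f hf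
    have := hf.le_card_add_one h.toIsIndepPair hchi hS
    omega
  have hclique : ∀ z ∈ outside A B, ∀ z' ∈ outside A B, z ≠ z' → G.Adj z z' :=
    fun z hz z' hz' hne => h.adj_of_forall_not_isBicoloring hcrit hz hz' hne
  rcases h.forall_exists_adj_left_or_right hcrit (by omega) with hleft | hright
  · obtain ⟨a, ha⟩ := h.exists_isBipartiteWithClique_of_forall_exists_adj hA hclique
      (by omega) hleft
    exact ⟨A, B, a, ha, hcard⟩
  · rw [outside_comm] at hclique hright hcard
    obtain ⟨b, hb⟩ := h.symm.exists_isBipartiteWithClique_of_forall_exists_adj hB hclique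
      (by omega) hright
    exact ⟨B, A, b, hb, hcard⟩

end IsCore

end CliqueOutside

section SpectralRadius

variable {V W : Type*} [Fintype V] [Fintype W]

theorem neighborsIn_univ (G : SimpleGraph V) [DecidableRel G.Adj] (v : V) :
    neighborsIn G v univ = G.neighborFinset v := by
  ext w
  simp

theorem adjSpectralRadius_eq_spectralRadius (G : SimpleGraph V) [DecidableEq V]
    [DecidableRel G.Adj] : G.adjSpectralRadius = spectralRadius ℂ (G.adjMatrix ℂ) := by
  unfold adjSpectralRadius
  congr!

theorem adjSpectralRadius_congr {G : SimpleGraph V} {H : SimpleGraph W} (e : G ≃g H) :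
    G.adjSpectralRadius = H.adjSpectralRadius := by
  classical
  rw [adjSpectralRadius_eq_spectralRadius, adjSpectralRadius_eq_spectralRadius, spectralRadius,
    spectralRadius]
  have hreindex :
      G.adjMatrix ℂ = Matrix.reindexAlgEquiv ℂ ℂ e.toEquiv.symm (H.adjMatrix ℂ) := by
    ext u v
    simp [adjMatrix_apply, e.map_adj_iff]
  rw [hreindex, AlgEquiv.spectrum_eq]

theorem exists_isSubEigenvector [Nonempty V] (G : SimpleGraph V) :
    ∃ lam : ℝ, 0 ≤ lam ∧ G.adjSpectralRadius = ENNReal.ofReal lam ∧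
      ∃ x, IsSubEigenvector G x lam := by
  classical
  let _ := Matrix.linftyOpNormedRing (n := V) (α := ℂ)
  let _ := Matrix.linftyOpNormedAlgebra (R := ℂ) (n := V) (α := ℂ)
  obtain ⟨μ, hμ, hμr⟩ := spectrum.exists_nnnorm_eq_spectralRadius (G.adjMatrix ℂ)
  rw [← Matrix.spectrum_toLin', ← Module.End.hasEigenvalue_iff_mem_spectrum] at hμ
  obtain ⟨y, hy⟩ := hμ.exists_hasEigenvector
  refine ⟨‖μ‖, norm_nonneg _, ?_, fun v => ‖y v‖, fun v => norm_nonneg _, ?_, fun v => ?_⟩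
  · rw [adjSpectralRadius_eq_spectralRadius, ← hμr, ofReal_norm, enorm_eq_nnnorm]
  · obtain ⟨v, hv⟩ := Function.ne_iff.mp hy.2
    exact ⟨v, norm_pos_iff.mpr hv⟩
  · have hmul : μ * y v = ∑ w ∈ neighborsIn G v univ, y w := by
      rw [neighborsIn_univ, ← adjMatrix_mulVec_apply, ← Matrix.toLin'_apply, hy.apply_eq_smul,
        Pi.smul_apply, smul_eq_mul]
    rw [← norm_mul, hmul]
    exact norm_sum_le _ _

theorem ofReal_le_adjSpectralRadius {G : SimpleGraph V} {x : V → ℝ} {lam : ℝ}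
    (hx : ∃ v, x v ≠ 0) (h : ∀ v, ∑ w ∈ neighborsIn G v univ, x w = lam * x v) :
    ENNReal.ofReal lam ≤ G.adjSpectralRadius := by
  classical
  have hmem : (lam : ℂ) ∈ spectrum ℂ (G.adjMatrix ℂ) := by
    rw [← Matrix.spectrum_toLin', ← Module.End.hasEigenvalue_iff_mem_spectrum]
    refine Module.End.hasEigenvalue_of_hasEigenvector (x := fun v => (x v : ℂ)) ?_
    rw [Module.End.hasEigenvector_iff, Module.End.mem_eigenspace_iff]
    refine ⟨?_, ?_⟩
    · ext v
      rw [Matrix.toLin'_apply, adjMatrix_mulVec_apply, ← neighborsIn_univ, Pi.smul_apply,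
        smul_eq_mul]
      exact_mod_cast h v
    · obtain ⟨v, hv⟩ := hx
      exact Function.ne_iff.mpr ⟨v, by simpa using hv⟩
  rw [adjSpectralRadius_eq_spectralRadius]
  calc ENNReal.ofReal lam ≤ ENNReal.ofReal ‖(lam : ℂ)‖ :=
        ENNReal.ofReal_le_ofReal ((le_abs_self lam).trans_eq (Complex.norm_real lam).symm)
    _ = ‖(lam : ℂ)‖₊ := by rw [ofReal_norm, enorm_eq_nnnorm]
    _ ≤ _ := le_iSup₂ (f := fun (z : ℂ) (_ : z ∈ spectrum ℂ (G.adjMatrix ℂ)) =>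
      (‖z‖₊ : ENNReal)) (lam : ℂ) hmem

end SpectralRadius

section CliqueExcess

variable {c lam l : ℝ}

/-- The amount `κ` by which attaching a clique on `c + 1` vertices to one vertex of the complete
bipartite graph with parts of sizes `s` and `t` changes the equation `λ² = t * s` of the spectral
radius, which becomes `λ² = t * (s + κ)`. -/
noncomputable def cliqueExcess (c lam : ℝ) : ℝ := c / ((lam + 1) * (lam - c))

theorem cliqueExcess_pos (hc : 0 < c) (h : c < lam) : 0 < cliqueExcess c lam :=
  div_pos hc (mul_pos (by linarith) (by linarith))

theorem cliqueExcess_lt_one (hc : 0 < c) (h : c + 1 < lam) : cliqueExcess c lam < 1 := by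
  rw [cliqueExcess, div_lt_one (mul_pos (by linarith) (by linarith))]
  nlinarith

theorem cliqueExcess_anti (hc : 0 < c) (h : c < l) (hl : l ≤ lam) :
    cliqueExcess c lam ≤ cliqueExcess c l := by
  refine div_le_div_of_nonneg_left hc.le (mul_pos (by linarith) (by linarith)) ?_
  gcongr
  linarith

theorem continuousOn_cliqueExcess (hc : 0 < c) : ContinuousOn (cliqueExcess c) (Set.Ioi c) := by
  refine continuousOn_const.div (by fun_prop) fun l hl => ?_
  rw [Set.mem_Ioi] at hl
  exact (mul_pos (by linarith) (by linarith)).ne'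

theorem exists_sq_eq_mul_add_cliqueExcess {s t : ℝ} (hc : 0 < c) (hs : 0 ≤ s) (ht : 0 ≤ t)
    (hst : c + 1 < √(s * t)) : ∃ l, √(s * t) ≤ l ∧ l ^ 2 = t * (s + cliqueExcess c l) := by
  have hle : √(s * t) ≤ √((s + 1) * t) := Real.sqrt_le_sqrt (by gcongr; linarith)
  let f : ℝ → ℝ := fun l => l ^ 2 - t * (s + cliqueExcess c l)
  have hcont : ContinuousOn f (Set.Icc (√(s * t)) (√((s + 1) * t))) := by
    have hmem : Set.Icc (√(s * t)) (√((s + 1) * t)) ⊆ Set.Ioi c := fun l hl =>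
      Set.mem_Ioi.mpr (by linarith [hl.1])
    have := (continuousOn_cliqueExcess hc).mono hmem
    fun_prop
  have hlow : f (√(s * t)) ≤ 0 := by
    have := mul_nonneg ht (cliqueExcess_pos hc (by linarith : c < √(s * t))).le
    simp only [f]
    rw [Real.sq_sqrt (by positivity)]
    linarith
  have hhigh : 0 ≤ f (√((s + 1) * t)) := by
    have := mul_le_mul_of_nonneg_left
      (cliqueExcess_lt_one hc (by linarith : c + 1 < √((s + 1) * t))).le ht
    simp only [f]
    rw [Real.sq_sqrt (by positivity)]
    linarith
  obtain ⟨l, hl, hfl⟩ := intermediate_value_Icc hle hcont ⟨hlow, hhigh⟩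
  exact ⟨l, hl.1, sub_eq_zero.mp hfl⟩

end CliqueExcess

section BipartiteWithClique

variable {V : Type*} [Fintype V] {G : SimpleGraph V} {A B : Finset V} {a v : V} {M : Type*}
  [AddCommMonoid M]

/-- `IsBipartiteWithClique` with all the edges between `A` and `B`: a clique and a complete
bipartite graph sharing the vertex `a`. -/
structure IsCompleteBipartiteWithClique (G : SimpleGraph V) (A B : Finset V) (a : V) : Prop
    extends IsBipartiteWithClique G A B a where
  adj : ∀ v ∈ A, ∀ b ∈ B, G.Adj v b

namespace IsBipartiteWithClique

theorem neighborsIn_outside_root (h : IsBipartiteWithClique G A B a) :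
    neighborsIn G a (outside A B) = outside A B := by
  ext z
  rw [mem_neighborsIn, and_iff_left_iff_imp]
  exact fun hz => ((h.adj_iff z hz a).mpr (.inl rfl)).symm

theorem neighborsIn_outside_of_ne (h : IsBipartiteWithClique G A B a) (hv : v ∉ outside A B)
    (hva : v ≠ a) : neighborsIn G v (outside A B) = ∅ :=
  neighborsIn_eq_empty fun z hz hvz =>
    ((h.adj_iff z hz v).mp hvz.symm).elim hva fun hmem => hv hmem.1

theorem sum_neighborsIn_left (h : IsBipartiteWithClique G A B a) [DecidableEq V] (x : V → M)
    (hv : v ∈ A) :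
    ∑ w ∈ neighborsIn G v univ, x w =
      ∑ w ∈ neighborsIn G v B, x w + if v = a then ∑ w ∈ outside A B, x w else 0 := by
  rw [sum_neighborsIn_univ h.disjoint, neighborsIn_eq_empty (h.not_adj_left v hv), sum_empty,
    zero_add]
  split_ifs with hva
  · rw [hva, h.neighborsIn_outside_root]
  · rw [h.neighborsIn_outside_of_ne (fun hout => (mem_outside.mp hout).1 hv) hva, sum_empty]

theorem sum_neighborsIn_right (h : IsBipartiteWithClique G A B a) (x : V → M) (hv : v ∈ B) :
    ∑ w ∈ neighborsIn G v univ, x w = ∑ w ∈ neighborsIn G v A, x w := by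
  have hva : v ≠ a := fun hva => disjoint_left.mp h.disjoint h.mem_left (hva ▸ hv)
  rw [sum_neighborsIn_univ h.disjoint, neighborsIn_eq_empty (h.not_adj_right v hv), sum_empty,
    add_zero, h.neighborsIn_outside_of_ne (fun hout => (mem_outside.mp hout).2 hv) hva, sum_empty,
    add_zero]

theorem sum_neighborsIn_outside (h : IsBipartiteWithClique G A B a) [DecidableEq V] (x : V → M)
    (hv : v ∈ outside A B) :
    ∑ w ∈ neighborsIn G v univ, x w = x a + ∑ w ∈ (outside A B).erase v, x w := by
  have haout : a ∉ (outside A B).erase v := fun ha =>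
    (mem_outside.mp (mem_of_mem_erase ha)).1 h.mem_left
  rw [← sum_insert haout]
  congr 1
  ext w
  simp only [mem_neighborsIn, mem_univ, true_and, h.adj_iff v hv, mem_insert, mem_erase]
  tauto

end IsBipartiteWithClique

namespace IsCompleteBipartiteWithClique

theorem neighborsIn_right (h : IsCompleteBipartiteWithClique G A B a) (hv : v ∈ A) :
    neighborsIn G v B = B := by
  ext b
  simpa using h.adj v hv b

theorem neighborsIn_left (h : IsCompleteBipartiteWithClique G A B a) (hv : v ∈ B) :
    neighborsIn G v A = A := by
  ext b
  simpa using fun hb => (h.adj b hb v hv).symm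

theorem sum_neighborsIn_eq_mul (h : IsCompleteBipartiteWithClique G A B a) {x : V → ℝ}
    {l E : ℝ} (hl : 0 < l) (hB : 0 < #B) (hE : E = (l + 1) * (l - #(outside A B)))
    (hlE : l ^ 2 * E = #B * (#A * E + #(outside A B)))
    (hxa : x a = l - #(outside A B) + 1) (hxA : ∀ w ∈ A, w ≠ a → x w = E / l)
    (hxB : ∀ w ∈ B, x w = E / #B) (hxout : ∀ w ∈ outside A B, x w = 1) (v : V) :
    ∑ w ∈ neighborsIn G v univ, x w = l * x v := by
  classical
  have hB0 : (0 : ℝ) < #B := by exact_mod_cast hB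
  have hla : l * x a = E + #(outside A B) := by rw [hxa, hE]; ring
  have hsumB : ∑ w ∈ B, x w = E := by
    rw [sum_congr rfl hxB, sum_const, nsmul_eq_mul, mul_div_cancel₀ _ hB0.ne']
  have hsumA : ∑ w ∈ A, x w = x a + (#A - 1) * (E / l) := by
    rw [← add_sum_erase _ _ h.mem_left,
      sum_congr rfl fun w hw => hxA w (mem_of_mem_erase hw) (ne_of_mem_erase hw), sum_const,
      card_erase_of_mem h.mem_left, nsmul_eq_mul, Nat.cast_pred (card_pos.mpr ⟨a, h.mem_left⟩)]
  by_cases hvA : v ∈ A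
  · rw [h.sum_neighborsIn_left x hvA, h.neighborsIn_right hvA, hsumB]
    split_ifs with hva
    · rw [hva, hla, sum_congr rfl hxout, sum_const, nsmul_one]
    · rw [hxA v hvA hva, add_zero, mul_div_cancel₀ _ hl.ne']
  by_cases hvB : v ∈ B
  · rw [h.sum_neighborsIn_right x hvB, h.neighborsIn_left hvB, hsumA, hxB v hvB]
    field_simp
    linear_combination #B * hla - hlE
  · have hvout := mem_outside.mpr ⟨hvA, hvB⟩
    rw [h.sum_neighborsIn_outside x hvout,
      sum_congr rfl fun w hw => hxout w (mem_of_mem_erase hw), sum_const,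
      card_erase_of_mem hvout, nsmul_one, Nat.cast_pred (card_pos.mpr ⟨v, hvout⟩), hxa,
      hxout v hvout]
    ring

theorem ofReal_le_adjSpectralRadius_of_sq_eq (h : IsCompleteBipartiteWithClique G A B a) {l : ℝ}
    (hB : 0 < #B) (hlc : #(outside A B) < l)
    (hl : l ^ 2 = #B * (#A + cliqueExcess #(outside A B) l)) :
    ENNReal.ofReal l ≤ G.adjSpectralRadius := by
  classical
  have hl0 : 0 < l := (Nat.cast_nonneg _).trans_lt hlc
  let E : ℝ := (l + 1) * (l - #(outside A B))
  have hE : 0 < E := mul_pos (by linarith) (by linarith)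
  have hlE : l ^ 2 * E = #B * (#A * E + #(outside A B)) := by
    rw [hl, cliqueExcess, mul_assoc, add_mul, div_mul_cancel₀ _ hE.ne']
  let x : V → ℝ := fun v =>
    if v = a then l - #(outside A B) + 1 else if v ∈ A then E / l else if v ∈ B then E / #B else 1
  have hne {v : V} (hv : v ∉ A) : v ≠ a := fun hva => hv (hva ▸ h.mem_left)
  have hxa : x a = l - #(outside A B) + 1 := if_pos rfl
  refine ofReal_le_adjSpectralRadius (x := x) ⟨a, by linarith⟩ ?_
  refine h.sum_neighborsIn_eq_mul hl0 hB rfl hlE hxa ?_ ?_ ?_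
  · intro w hw hwa
    simp [x, E, hw, hwa]
  · intro w hw
    have hwA := disjoint_right.mp h.disjoint hw
    simp [x, E, hw, hwA, hne hwA]
  · intro w hw
    rw [mem_outside] at hw
    simp [x, hw, hne hw.1]

theorem le_adjSpectralRadius (h : IsCompleteBipartiteWithClique G A B a)
    (hout : 0 < #(outside A B)) (hB : 0 < #B) (hlt : #(outside A B) + 1 < √(#A * #B : ℝ)) :
    ∃ l : ℝ, √(#A * #B) ≤ l ∧ l ^ 2 = #B * (#A + cliqueExcess #(outside A B) l) ∧
      ENNReal.ofReal l ≤ G.adjSpectralRadius := by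
  obtain ⟨l, hle, hl⟩ := exists_sq_eq_mul_add_cliqueExcess (by exact_mod_cast hout)
    (Nat.cast_nonneg #A) (Nat.cast_nonneg #B) hlt
  exact ⟨l, hle, hl, h.ofReal_le_adjSpectralRadius_of_sq_eq hB (by linarith) hl⟩

end IsCompleteBipartiteWithClique

end BipartiteWithClique

section UpperBound

variable {V : Type*} [Fintype V] {G : SimpleGraph V} {A B : Finset V} {a v : V} {x : V → ℝ}
  {lam : ℝ}

namespace IsBipartiteWithClique

theorem mul_le_of_mem_left [DecidableEq V] (h : IsBipartiteWithClique G A B a)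
    (hx : IsSubEigenvector G x lam) (hv : v ∈ A) :
    lam * x v ≤ ∑ b ∈ B, x b + if v = a then ∑ w ∈ outside A B, x w else 0 :=
  calc lam * x v ≤ _ := hx.mul_le v
    _ = _ := h.sum_neighborsIn_left x hv
    _ ≤ _ := add_le_add_left (sum_neighborsIn_le_sum hx.nonneg) _

theorem add_one_mul_sum_outside_le (h : IsBipartiteWithClique G A B a)
    (hx : IsSubEigenvector G x lam) :
    (lam + 1) * ∑ w ∈ outside A B, x w ≤ #(outside A B) * (x a + ∑ w ∈ outside A B, x w) := by
  classical
  rw [mul_sum, ← nsmul_eq_mul]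
  refine sum_le_card_nsmul _ _ _ fun w hw => ?_
  have hmul := (hx.mul_le w).trans_eq (h.sum_neighborsIn_outside x hw)
  rw [← add_sum_erase _ x hw]
  linarith

theorem sum_outside_le (h : IsBipartiteWithClique G A B a) (hx : IsSubEigenvector G x lam)
    (hlam : #(outside A B) < lam) :
    ∑ w ∈ outside A B, x w ≤ cliqueExcess #(outside A B) lam * ∑ b ∈ B, x b := by
  classical
  have hc : (0 : ℝ) ≤ #(outside A B) := Nat.cast_nonneg _
  have hroot := h.mul_le_of_mem_left hx h.mem_left
  rw [if_pos rfl] at hroot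
  have hclique := h.add_one_mul_sum_outside_le hx
  rw [cliqueExcess, div_mul_eq_mul_div, le_div_iff₀ (mul_pos (by linarith) (by linarith))]
  have hlam0 : 0 ≤ lam := hc.trans hlam.le
  linarith [mul_le_mul_of_nonneg_left hclique hlam0, mul_le_mul_of_nonneg_left hroot hc]

theorem sum_right_pos (h : IsBipartiteWithClique G A B a) (hx : IsSubEigenvector G x lam)
    (hlam : #(outside A B) < lam) : 0 < ∑ b ∈ B, x b := by
  classical
  by_contra! hle
  have hlam0 : 0 < lam := (Nat.cast_nonneg _).trans_lt hlam
  have hsumB : ∑ b ∈ B, x b = 0 := hle.antisymm (sum_nonneg fun b _ => hx.nonneg b)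
  have hsumout : ∑ w ∈ outside A B, x w = 0 :=
    le_antisymm (by simpa [hsumB] using h.sum_outside_le hx hlam)
      (sum_nonneg fun w _ => hx.nonneg w)
  obtain ⟨v, hv⟩ := hx.exists_pos
  have hne {S : Finset V} (hS : ∑ w ∈ S, x w = 0) : v ∉ S := fun hvS =>
    hv.ne' ((sum_eq_zero_iff_of_nonneg fun w _ => hx.nonneg w).mp hS v hvS)
  have hvA : v ∈ A := by
    by_contra hvA
    exact hne hsumout (mem_outside.mpr ⟨hvA, hne hsumB⟩)
  have hmul := h.mul_le_of_mem_left hx hvA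
  rw [hsumB, hsumout, ite_self, add_zero] at hmul
  exact (mul_pos hlam0 hv).not_ge hmul

theorem sq_mul_sum_right_le [DecidableEq V] (h : IsBipartiteWithClique G A B a)
    (hx : IsSubEigenvector G x lam) (hlam : 0 ≤ lam) :
    lam ^ 2 * ∑ b ∈ B, x b ≤ ∑ v ∈ A, #(neighborsIn G v B) *
      (∑ b ∈ B, x b + if v = a then ∑ w ∈ outside A B, x w else 0) :=
  calc lam ^ 2 * ∑ b ∈ B, x b = lam * ∑ b ∈ B, lam * x b := by rw [← mul_sum]; ring
    _ ≤ lam * ∑ b ∈ B, ∑ v ∈ neighborsIn G b A, x v := by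
      gcongr with b hb
      exact (hx.mul_le b).trans_eq (h.sum_neighborsIn_right x hb)
    _ = ∑ v ∈ A, #(neighborsIn G v B) * (lam * x v) := by
      simp only [sum_sum_neighborsIn, mul_sum, nsmul_eq_mul, mul_left_comm]
    _ ≤ _ := by
      gcongr with v hv
      exact h.mul_le_of_mem_left hx hv

theorem sum_card_right_mul_le [DecidableEq V] (h : IsBipartiteWithClique G A B a)
    (hx : IsSubEigenvector G x lam) (hlam : #(outside A B) < lam) :
    ∑ v ∈ A, #B * (∑ b ∈ B, x b + if v = a then ∑ w ∈ outside A B, x w else 0) ≤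
      #B * (#A + cliqueExcess #(outside A B) lam) * ∑ b ∈ B, x b := by
  rw [← mul_sum, sum_add_distrib, sum_const, nsmul_eq_mul, sum_ite_eq', if_pos h.mem_left,
    mul_assoc, add_mul]
  gcongr
  exact h.sum_outside_le hx hlam

theorem card_neighborsIn_mul_add_ite_le [DecidableEq V] (hx : IsSubEigenvector G x lam) (v : V) :
    #(neighborsIn G v B) * (∑ b ∈ B, x b + if v = a then ∑ w ∈ outside A B, x w else 0) ≤
      #B * (∑ b ∈ B, x b + if v = a then ∑ w ∈ outside A B, x w else 0) := by
  have hB : 0 ≤ ∑ b ∈ B, x b := sum_nonneg fun b _ => hx.nonneg b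
  have hout : 0 ≤ ∑ w ∈ outside A B, x w := sum_nonneg fun w _ => hx.nonneg w
  gcongr
  exact neighborsIn_subset

theorem sq_le (h : IsBipartiteWithClique G A B a) (hx : IsSubEigenvector G x lam)
    (hlam : #(outside A B) < lam) :
    lam ^ 2 ≤ #B * (#A + cliqueExcess #(outside A B) lam) := by
  classical
  have hlam0 : 0 ≤ lam := (Nat.cast_nonneg _).trans hlam.le
  exact le_of_mul_le_mul_right ((h.sq_mul_sum_right_le hx hlam0).trans
    ((sum_le_sum fun v _ => card_neighborsIn_mul_add_ite_le hx v).trans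
      (h.sum_card_right_mul_le hx hlam)))
    (h.sum_right_pos hx hlam)

theorem isCompleteBipartiteWithClique_of_le_sq (h : IsBipartiteWithClique G A B a)
    (hx : IsSubEigenvector G x lam) (hlam : #(outside A B) < lam)
    (hle : #B * (#A + cliqueExcess #(outside A B) lam) ≤ lam ^ 2) :
    IsCompleteBipartiteWithClique G A B a := by
  classical
  refine ⟨h, fun v hv b hb => ?_⟩
  have hlam0 : 0 ≤ lam := (Nat.cast_nonneg _).trans hlam.le
  have hpos := h.sum_right_pos hx hlam
  have hout : 0 ≤ ∑ w ∈ outside A B, x w := sum_nonneg fun w _ => hx.nonneg w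
  have hterm_le (v : V) (_ : v ∈ A) :=
    card_neighborsIn_mul_add_ite_le (A := A) (B := B) (a := a) hx v
  have hterms := (sum_eq_sum_iff_of_le hterm_le).mp <|
    (sum_le_sum hterm_le).antisymm <|
      (h.sum_card_right_mul_le hx hlam).trans <|
        (mul_le_mul_of_nonneg_right hle hpos.le).trans (h.sq_mul_sum_right_le hx hlam0)
  have hcard : #(neighborsIn G v B) = #B := by
    refine Nat.cast_injective (R := ℝ) (mul_right_cancel₀ (ne_of_gt ?_) (hterms v hv))
    split_ifs <;> linarith
  by_contra hvb
  exact (card_neighborsIn_lt hb hvb).ne hcard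

end IsBipartiteWithClique

end UpperBound

section Iso

variable {V W : Type*} [Fintype V] [Fintype W] {G : SimpleGraph V} {H : SimpleGraph W}
  {A B : Finset V} {A' B' : Finset W} {a : V} {a' : W} {u v : V}

theorem card_filter_decide_mem_prod_eq [DecidableEq V] (h : Disjoint A B) (p q : Bool) :
    #{v | (decide (v ∈ A), decide (v ∈ B)) = (p, q)} =
      cond p (cond q 0 #A) (cond q #B #(outside A B)) := by
  have hAB := disjoint_left.mp h
  cases p <;> cases q
  all_goals
    simp only [Prod.mk.injEq, decide_eq_true_eq, decide_eq_false_iff_not, cond_true, cond_false,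
      card_eq_zero]
    try congr 1
    ext v
    have := @hAB v
    simp
    try tauto

theorem exists_equiv_mem_iff (h : Disjoint A B) (h' : Disjoint A' B') (hA : #A = #A')
    (hB : #B = #B') (hout : #(outside A B) = #(outside A' B')) :
    ∃ e : V ≃ W, (∀ v, e v ∈ A' ↔ v ∈ A) ∧ ∀ v, e v ∈ B' ↔ v ∈ B := by
  classical
  have e (c : Bool × Bool) : {v // (decide (v ∈ A), decide (v ∈ B)) = c} ≃
      {w // (decide (w ∈ A'), decide (w ∈ B')) = c} := by
    refine Fintype.equivOfCardEq ?_
    rw [Fintype.card_subtype, Fintype.card_subtype, card_filter_decide_mem_prod_eq h,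
      card_filter_decide_mem_prod_eq h', hA, hB, hout]
  have hmem (v : V) := Equiv.ofFiberEquiv_map e v
  simp only [Prod.mk.injEq, decide_eq_decide] at hmem
  exact ⟨Equiv.ofFiberEquiv e, fun v => (hmem v).1, fun v => (hmem v).2⟩

namespace IsCompleteBipartiteWithClique

theorem adj_iff_mem (h : IsCompleteBipartiteWithClique G A B a) :
    G.Adj u v ↔ u ∈ A ∧ v ∈ B ∨ u ∈ B ∧ v ∈ A ∨
      u ≠ v ∧ (u = a ∨ u ∉ A ∧ u ∉ B) ∧ (v = a ∨ v ∉ A ∧ v ∉ B) := by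
  have hAB (w : V) (hw : w ∈ A) : w ∉ B := Finset.disjoint_left.mp h.disjoint hw
  have hu : u ∉ A ∧ u ∉ B → _ := fun hz => h.adj_iff u (mem_outside.mpr hz) v
  have hv : v ∉ A ∧ v ∉ B → _ := fun hz => h.adj_iff v (mem_outside.mpr hz) u
  rw [mem_outside, adj_comm] at hv
  rw [mem_outside] at hu
  have hleft := fun hu => h.not_adj_left u hu v
  have hright := fun hu => h.not_adj_right u hu v
  have huv := fun hu => h.adj u hu v
  have hvu := fun hv hu => (h.adj v hv u hu).symm
  have ha := h.mem_left
  have hne := G.ne_of_adj (a := u) (b := v)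
  grind

theorem nonempty_iso (h : IsCompleteBipartiteWithClique G A B a)
    (h' : IsCompleteBipartiteWithClique H A' B' a') (hA : #A = #A') (hB : #B = #B')
    (hout : #(outside A B) = #(outside A' B')) : Nonempty (G ≃g H) := by
  classical
  obtain ⟨e, heA, heB⟩ := exists_equiv_mem_iff h.disjoint h'.disjoint hA hB hout
  have hswap {S : Finset W} (hS : e a ∈ S ↔ a' ∈ S) (w : W) :
      Equiv.swap (e a) a' w ∈ S ↔ w ∈ S := by
    rw [Equiv.swap_apply_def]
    split_ifs with h₁ h₂
    · rw [h₁, hS]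
    · rw [h₂, hS]
    · rfl
  let f : V ≃ W := e.trans (Equiv.swap (e a) a')
  have hfa : f a = a' := Equiv.swap_apply_left _ _
  have hfA (v : V) : f v ∈ A' ↔ v ∈ A :=
    (hswap (iff_of_true ((heA a).mpr h.mem_left) h'.mem_left) _).trans (heA v)
  have hfB (v : V) : f v ∈ B' ↔ v ∈ B := by
    refine (hswap (iff_of_false ?_ (Finset.disjoint_left.mp h'.disjoint h'.mem_left)) _).trans
      (heB v)
    exact (heB a).not.mpr (Finset.disjoint_left.mp h.disjoint h.mem_left)
  refine ⟨f, @fun u v => ?_⟩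
  rw [h.adj_iff_mem, h'.adj_iff_mem, ← hfa]
  simp only [hfA, hfB, f.apply_eq_iff_eq, ne_eq]

end IsCompleteBipartiteWithClique

end Iso

section IdentifyVertex

variable {α β γ : Type*} [Fintype α] [Fintype β] [Fintype γ] [DecidableEq γ] (a : α) (c : γ)

theorem exists_isCompleteBipartiteWithClique_identifyVertex :
    ∃ A B v, IsCompleteBipartiteWithClique
      ((completeBipartiteGraph α β).identifyVertex (.inl a) (completeGraph γ) c) A B v ∧
        #A = Fintype.card α ∧ #B = Fintype.card β ∧ #(outside A B) + 1 = Fintype.card γ := by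
  let A : Finset ((α ⊕ β) ⊕ {w // w ≠ c}) := univ.map (Function.Embedding.inl.trans .inl)
  let B : Finset ((α ⊕ β) ⊕ {w // w ≠ c}) := univ.map (Function.Embedding.inr.trans .inl)
  have hdisj : Disjoint A B := by simp [A, B, Finset.disjoint_left]
  have hA : #A = Fintype.card α := card_map _
  have hB : #B = Fintype.card β := card_map _
  refine ⟨A, B, .inl (.inl a), ⟨⟨⟨hdisj, ?_, ?_⟩, ?_, ?_⟩, ?_⟩, hA, hB, ?_⟩
  · simp [A, identifyVertex]
  · simp [B, identifyVertex]
  · simp [A]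
  · rintro ((v | v) | v) hv w
    · simp [A] at hv
    · simp [B] at hv
    · rcases w with (w | w) | w <;> simp [A, B, identifyVertex, v.2.symm, Subtype.coe_inj]
  · simp [A, B, identifyVertex]
  · have hcard := card_add_card_add_card_outside hdisj
    have hpos := Fintype.card_pos_iff.mpr ⟨c⟩
    rw [hA, hB, Fintype.card_sum, Fintype.card_sum, Fintype.card_subtype_compl,
      Fintype.card_subtype_eq] at hcard
    lia

end IdentifyVertex

theorem sq_sub_one_le_four_mul_half_mul_half (m : ℕ) :
    (m : ℝ) ^ 2 - 1 ≤ 4 * ((m / 2 : ℕ) * ((m + 1) / 2 : ℕ)) := by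
  obtain ⟨q, rfl | rfl⟩ := m.even_or_odd'
  · rw [show 2 * q / 2 = q by lia, show (2 * q + 1) / 2 = q by lia]
    push_cast
    linarith
  · rw [show (2 * q + 1) / 2 = q by lia, show (2 * q + 1 + 1) / 2 = q + 1 by lia]
    push_cast
    linarith

theorem eq_half_of_mul_add_le {m s t : ℕ} (hst : s + t = m) {κ : ℝ} (h0 : 0 < κ) (h1 : κ < 1)
    (h : (((m + 1) / 2 : ℕ) : ℝ) * (((m / 2 : ℕ) : ℝ) + κ) ≤ t * (s + κ)) :
    s = m / 2 ∧ t = (m + 1) / 2 := by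
  obtain ⟨s', hs'⟩ : ∃ s', s' = m / 2 := ⟨_, rfl⟩
  obtain ⟨t', ht'⟩ : ∃ t', t' = (m + 1) / 2 := ⟨_, rfl⟩
  rw [← hs', ← ht'] at h ⊢
  have hsum : (s : ℝ) = s' + t' - t := by
    rw [eq_sub_iff_add_eq]
    exact_mod_cast (by lia : s + t = s' + t')
  have hdiff : ((t : ℝ) - t') * (t - s' - κ) ≤ 0 := by
    rw [hsum] at h
    linarith
  suffices t = t' by lia
  rcases lt_trichotomy t t' with hlt | heq | hgt
  · have htt' : (t : ℝ) < t' := by exact_mod_cast hlt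
    have hts' : (t : ℝ) ≤ s' := by exact_mod_cast (by lia : t ≤ s')
    exact absurd hdiff (mul_pos_of_neg_of_neg (by linarith) (by linarith)).not_ge
  · exact heq
  · have htt' : (t' : ℝ) < t := by exact_mod_cast hgt
    have hts' : (s' : ℝ) + 1 ≤ t := by exact_mod_cast (by lia : s' + 1 ≤ t)
    exact absurd hdiff (mul_pos (by linarith) (by linarith)).not_ge

section Extremal

variable {V W : Type*} [Fintype V] [Fintype W] {G : SimpleGraph V} {H : SimpleGraph W}
  {A B : Finset V} {A' B' : Finset W} {a : V} {a' : W} {x : V → ℝ} {l lam : ℝ} {k r n : ℕ}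

theorem IsBipartiteWithClique.nonempty_iso_of_le (h : IsBipartiteWithClique G A B a)
    (h' : IsCompleteBipartiteWithClique H A' B' a') (hx : IsSubEigenvector G x lam)
    (hsum : #A + #B = n) (hA' : #A' = n / 2) (hB' : #B' = (n + 1) / 2)
    (hout : #(outside A B) = #(outside A' B')) (hpos : 0 < #(outside A' B'))
    (hlt : #(outside A' B') + 1 < l) (hl : l ^ 2 = #B' * (#A' + cliqueExcess #(outside A' B') l))
    (hle : l ≤ lam) : Nonempty (G ≃g H) := by
  have hpos' : (0 : ℝ) < #(outside A' B') := by exact_mod_cast hpos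
  have hlam : (#(outside A' B') : ℝ) + 1 < lam := hlt.trans_le hle
  have hsq : #B' * (#A' + cliqueExcess #(outside A' B') lam) ≤ lam ^ 2 :=
    calc #B' * (#A' + cliqueExcess #(outside A' B') lam)
      _ ≤ #B' * (#A' + cliqueExcess #(outside A' B') l) := by
        gcongr
        exact cliqueExcess_anti hpos' (by linarith) hle
      _ = l ^ 2 := hl.symm
      _ ≤ lam ^ 2 := by
        gcongr
        linarith
  have hlam' : (#(outside A B) : ℝ) < lam := by
    rw [hout]
    linarith
  have hsq' := h.sq_le hx hlam'
  rw [← hout] at hsq hpos' hlam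
  obtain ⟨hA, hB⟩ := eq_half_of_mul_add_le hsum (cliqueExcess_pos hpos' hlam')
    (cliqueExcess_lt_one hpos' hlam) (hA' ▸ hB' ▸ hsq.trans hsq')
  rw [hA', hB', ← hA, ← hB] at hsq
  exact (h.isCompleteBipartiteWithClique_of_le_sq hx hlam' hsq).nonempty_iso h'
    (hA.trans hA'.symm) (hB.trans hB'.symm) hout

theorem exists_isCompleteBipartiteWithClique_turanIdentifyClique (hr : 1 ≤ r) (hrn : r < n) :
    ∃ A B v, IsCompleteBipartiteWithClique (turanIdentifyClique n r hr hrn) A B v ∧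
      #A = (n - r + 1) / 2 ∧ #B = (n - r + 1 + 1) / 2 ∧ #(outside A B) + 1 = r := by
  have h := exists_isCompleteBipartiteWithClique_identifyVertex (β := Fin ((n - r + 1 + 1) / 2))
    (⟨0, by lia⟩ : Fin ((n - r + 1) / 2)) (⟨0, hr⟩ : Fin r)
  simp only [Fintype.card_fin] at h
  exact h

theorem mul_le_of_sq_sub_one_le {N K c lam : ℝ} (hlam : 0 ≤ lam) (hN : 712 * K ≤ N)
    (hcK : c + 1 ≤ 2 * K) (hK : 0 ≤ K) (h : (N - c) ^ 2 - 1 ≤ 4 * lam ^ 2) : 0.4985 * N ≤ lam := by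
  have hsq : (N - 2 * K) ^ 2 ≤ (2 * lam) ^ 2 :=
    calc (N - 2 * K) ^ 2 ≤ (N - c - 1) ^ 2 := by
          rw [sq_le_sq₀] <;> linarith
      _ ≤ (N - c) ^ 2 - 1 := by linarith
      _ ≤ (2 * lam) ^ 2 := by linarith
  linarith [(sq_le_sq₀ (by linarith) (by linarith)).mp hsq]

theorem add_one_lt_sqrt {N K c P : ℝ} (hN : 712 * K ≤ N) (hc : 0 ≤ c) (hcK : c + 1 ≤ 2 * K)
    (hP : (N - c) ^ 2 - 1 ≤ 4 * P) : c + 1 < √P := by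
  refine Real.lt_sqrt_of_sq_lt ?_
  have hsq : (5 * K) ^ 2 ≤ (N - c) ^ 2 := by
    rw [sq_le_sq₀] <;> linarith
  have hcsq : (c + 1) ^ 2 ≤ (2 * K) ^ 2 := by gcongr
  have hK : 1 ≤ (2 * K) ^ 2 := one_le_pow₀ (by linarith)
  linarith

theorem nonempty_iso_turanIdentifyClique (hk : 2 ≤ k) (hr : 3 ≤ r) (hrk : r ≤ 2 * k)
    (hn : 712 * k ≤ n) (hr1 : 1 ≤ r) (hrn : r < n) (hV : Fintype.card V = n)
    (hfree : (cycleGraph (2 * k + 1)).Free G) (hchi : (r : ℕ∞) ≤ G.chromaticNumber)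
    (hle : (turanIdentifyClique n r hr1 hrn).adjSpectralRadius ≤ G.adjSpectralRadius) :
    Nonempty (G ≃g turanIdentifyClique n r hr1 hrn) := by
  have : Nonempty V := Fintype.card_pos_iff.mp (by lia)
  obtain ⟨A, B, v, hH, hA, hB, hout⟩ :=
    exists_isCompleteBipartiteWithClique_turanIdentifyClique hr1 hrn
  set c := #(outside A B)
  have hcK : (c : ℝ) + 1 ≤ 2 * k := by exact_mod_cast hout.trans_le hrk
  have hnK : 712 * (k : ℝ) ≤ n := by exact_mod_cast hn
  have hprod : ((n : ℝ) - c) ^ 2 - 1 ≤ 4 * (#A * #B) := by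
    rw [hA, hB, ← Nat.cast_sub (by lia), show n - r + 1 = n - c by lia]
    exact sq_sub_one_le_four_mul_half_mul_half (n - c)
  have hsqrt := add_one_lt_sqrt hnK c.cast_nonneg hcK hprod
  obtain ⟨l, hsqrtl, hl, hlH⟩ := hH.le_adjSpectralRadius (by lia) (by lia) hsqrt
  obtain ⟨lam, hlam0, hlamG, x, hx⟩ := exists_isSubEigenvector G
  have hllam : l ≤ lam :=
    (ENNReal.ofReal_le_ofReal_iff hlam0).mp (hlH.trans (hle.trans_eq hlamG))
  have hlamsq : ((Fintype.card V : ℝ) - c) ^ 2 - 1 ≤ 4 * lam ^ 2 := by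
    rw [hV]
    linarith [(Real.sqrt_le_left hlam0).mp (hsqrtl.trans hllam)]
  have hlam : 0.4985 * (Fintype.card V : ℝ) ≤ lam :=
    mul_le_of_sq_sub_one_le hlam0 (hV ▸ hnK) hcK k.cast_nonneg hlamsq
  obtain ⟨X, Y, hXY⟩ := hx.exists_isDensePair (by lia) (hV ▸ hn) hfree hlam
  obtain ⟨A', B', a, hG, hcard⟩ :=
    (hXY.isCore hk (hV ▸ hn) hfree).exists_isBipartiteWithClique hx hlam (by lia) (by lia) (by lia)
      hlamsq (hout ▸ hchi)
  have hsum := card_add_card_add_card_outside hG.disjoint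
  exact hG.nonempty_iso_of_le hH hx (by lia) hA hB hcard (by lia) (hsqrt.trans_le hsqrtl) hl hllam

end Extremal

end OddCycleSpectral

theorem mainTheorem5 {V : Type*} [Fintype V] (k r n : ℕ)
    (hk : 2 ≤ k) (hr : 3 ≤ r) (hrk : r ≤ 2 * k) (hn : 712 * k ≤ n)
    (G : SimpleGraph V) (hV : Fintype.card V = n)
    (hfree : (SimpleGraph.cycleGraph (2 * k + 1)).Free G)
    (hchi : (r : ℕ∞) ≤ G.chromaticNumber) :
    G.adjSpectralRadius ≤
        (turanIdentifyClique n r (by omega) (by omega)).adjSpectralRadius ∧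
      (G.adjSpectralRadius =
          (turanIdentifyClique n r (by omega) (by omega)).adjSpectralRadius ↔
        Nonempty (G ≃g turanIdentifyClique n r (by omega) (by omega))) := by
  have hiso := OddCycleSpectral.nonempty_iso_turanIdentifyClique hk hr hrk hn (by omega) (by omega)
    hV hfree hchi
  refine ⟨?_, fun h => hiso h.ge, fun ⟨e⟩ => OddCycleSpectral.adjSpectralRadius_congr e⟩
  by_contra! hlt
  obtain ⟨e⟩ := hiso hlt.le
  exact hlt.ne' (OddCycleSpectral.adjSpectralRadius_congr e)
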